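/- Let $J:\mathbb R^2\to[0,\infty)$ be measurable and even, i.e. $J(-z)=J(z)$. Suppose there are $\delta_0,\lambda,\Lambda>0$ and $0<\alpha,\beta<2$ with $$\frac{\lambda}{|z|^{2+\beta}}\le J(z)\le\frac{\Lambda}{|z|^{2+\alpha}}\qquad\text{for } 0<|z|\le\delta_0,$$ and constants $C_1,C_2\in\mathbb R$, $\theta>3$ and a continuous function $D:(0,\infty)\to[0,\infty)$ with $\lim_{r\to\infty}D(r)=0$ such that $$\int_{r<|z|<2r}J(z)\,dz\le C_1D(r)\quad\text{and}\quad D(r)<C_2\,r^{-\theta}\qquad\text{for all } r>\delta_0.$$ Let $c>0$, $f\in C^1(\mathbb R)$, and let $u\in C^2(\mathbb R^2)$ be a bounded classical solution of $$\Delta u+cL[u]+f(u)=0\ \text{ in }\mathbb R^2,\qquad L[u](x):=\lim_{\epsilon\to0^+}\int_{\{|x-y|>\epsilon\}}[u(y)-u(x)]\,J(x-y)\,dy,$$ which is stable, i.e. for every $\zeta\in C_c^1(\mathbb R^2)$ $$\int_{\mathbb R^2}f'(u(x))\zeta(x)^2\,dx\le\int_{\mathbb R^2}|\nabla\zeta(x)|^2\,dx+\frac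 c2\iint_{\mathbb R^2\times\mathbb R^2}[\zeta(x)-\zeta(y)]^2J(x-y)\,dx\,dy.$$ Then $u$ is one-dimensional: there are a unit vector $\tau\in\mathbb R^2$ and a function $g:\mathbb R\to\mathbb R$ such that $u(x)=g(\tau\cdot x)$ for all $x\in\mathbb R^2$. -/

import Mathlib

open MeasureTheory Filter Topology

noncomputable section

namespace JumpDiffusion

variable {n : ℕ}

/-- A nonnegative, measurable, even (hence symmetric, as `J(x, y) = J(x - y)`) jump kernel. -/
structure IsJumpKernel (J : EuclideanSpace ℝ (Fin n) → ℝ) : Prop where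
  nonneg : ∀ z, 0 ≤ J z
  measurable : Measurable J
  even : ∀ z, J (-z) = J z

/-- `lam / |z|^(n+β) ≤ J z ≤ Lam / |z|^(n+α)` for `0 < |z| ≤ δ₀`. -/
def ComparableNearOrigin (J : EuclideanSpace ℝ (Fin n) → ℝ) (lam Lam α β δ₀ : ℝ) : Prop :=
  ∀ z : EuclideanSpace ℝ (Fin n), 0 < ‖z‖ → ‖z‖ ≤ δ₀ →
    lam / ‖z‖ ^ ((n : ℝ) + β) ≤ J z ∧ J z ≤ Lam / ‖z‖ ^ ((n : ℝ) + α)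

/-- The mass of `J` in the annulus `r < |z| < 2r` is at most `C * D r`, for all `r > δ₀`.
The mass is a lower Lebesgue integral, so that it is in particular finite. -/
def AnnulusDecay (J : EuclideanSpace ℝ (Fin n) → ℝ) (C : ℝ) (D : ℝ → ℝ) (δ₀ : ℝ) : Prop :=
  ∀ r : ℝ, δ₀ < r →
    ∫⁻ z in {z : EuclideanSpace ℝ (Fin n) | r < ‖z‖ ∧ ‖z‖ < 2 * r}, ENNReal.ofReal (J z)
      ≤ ENNReal.ofReal (C * D r)

/-- `L[u](x)` exists and equals `ℓ`: the truncated integrals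
`∫_{|x-y|>ε} (u(y) - u(x)) J(x-y) dy` converge absolutely and tend to `ℓ` as `ε → 0⁺`. -/
def HasNonlocalValue (J u : EuclideanSpace ℝ (Fin n) → ℝ) (x : EuclideanSpace ℝ (Fin n))
    (ℓ : ℝ) : Prop :=
  (∀ ε : ℝ, 0 < ε → IntegrableOn (fun y => (u y - u x) * J (x - y)) {y | ε < ‖x - y‖}) ∧
  Tendsto (fun ε : ℝ => ∫ y in {y | ε < ‖x - y‖}, (u y - u x) * J (x - y)) (𝓝[>] 0) (𝓝 ℓ)

/-- `u` is a classical solution of `Δu + c L[u] + f(u) = 0` in `ℝⁿ`. -/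
def IsSolution (J : EuclideanSpace ℝ (Fin n) → ℝ) (c : ℝ) (f : ℝ → ℝ)
    (u : EuclideanSpace ℝ (Fin n) → ℝ) : Prop :=
  ContDiff ℝ 2 u ∧
  ∀ x, ∃ ℓ : ℝ, HasNonlocalValue J u x ℓ ∧ Laplacian.laplacian u x + c * ℓ + f (u x) = 0

/-- The stability inequality, for all test functions of class `C¹` with compact support. -/
def IsStable (J : EuclideanSpace ℝ (Fin n) → ℝ) (c : ℝ) (f : ℝ → ℝ)
    (u : EuclideanSpace ℝ (Fin n) → ℝ) : Prop :=
  ∀ ζ : EuclideanSpace ℝ (Fin n) → ℝ, ContDiff ℝ 1 ζ → HasCompactSupport ζ →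
    ∫ x, deriv f (u x) * ζ x ^ 2 ≤
      (∫ x, ‖gradient ζ x‖ ^ 2) +
        c / 2 * ∫ p : EuclideanSpace ℝ (Fin n) × EuclideanSpace ℝ (Fin n),
          (ζ p.1 - ζ p.2) ^ 2 * J (p.1 - p.2)

/-- `u` is a function of one variable: `u(x) = g(τ · x)` for a unit vector `τ`. -/
def IsOneDimensional (u : EuclideanSpace ℝ (Fin n) → ℝ) : Prop :=
  ∃ (τ : EuclideanSpace ℝ (Fin n)) (g : ℝ → ℝ), ‖τ‖ = 1 ∧ ∀ x, u x = g (inner ℝ τ x)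

end JumpDiffusion

end

open scoped Gradient

namespace JumpDiffusion

/-! The heart of the matter is that every directional derivative `∂ₑu` has a constant sign. Formally
`∂ₑu` solves the linearized equation, so its positive part, multiplied by a cutoff `η`, makes the
stability form at most the energy spent by `η`. In the plane this energy can be made arbitrarily
small by a logarithmic-type cutoff. The positive part is thus an almost minimizer of a nonnegative
quadratic form.

Suppose `∂ₑu ≤ 0` near `y₀` while `∂ₑu(x₀) > 0`, with `x₀` and `y₀` closer than `δ₀`. Add `t ψ`,
where `ψ ≥ 0` is a bump near `y₀`. The supports do not overlap, so the local cross terms vanish, but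
the nonlocal one is `-∬ (a(x) b(y) + a(y) b(x)) J(x - y)`, strictly negative because `J > 0` near
the origin. The form then drops by a multiple of `t` and rises only by `O(t²)`, which contradicts
stability for small `t`. Hence nonpositivity near a point spreads to a ball of fixed radius
(`fderiv_nonpos_propagates`), and by connectedness to the whole plane (`nonpos_of_propagates`).
Applying this to directions close to the orthogonal complement of one nonzero gradient forces all
gradients to be parallel (`isOneDimensional_of_fderiv_sign`).

Three devices make this rigorous. Since `u` is only `C²`, `∂ₑu` is replaced by difference quotients,
which are bounded weak solutions with an approximate linearized right-hand side
(`exists_diffQuot_error_le`). Since no global gradient bound is at hand, a Caccioppoli estimate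
(`IsWeakSolution.exists_gradient_bound`) controls them in uniformly local `L²`, uniformly in the
step, and this is all that the cutoff of `exists_cutoff` needs. Since test functions must be `C¹`,
the positive part `w⁺` is replaced by `w r(w)`, with `r` of tiny logarithmic slope
(`exists_value_cutoff`). The kernel enters through its second and third moments
(`integrable_moments`): the second gives the energies a meaning, the third pays for long jumps
across the cutoff. -/

/-- Euclidean space of dimension `n`. -/
abbrev Euc (n : ℕ) := EuclideanSpace ℝ (Fin n)

variable {n : ℕ}

/-! ### Gradient calculus and test functions. -/

theorem gradient_mul {a b : Euc n → ℝ} {x : Euc n} (ha : DifferentiableAt ℝ a x)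
    (hb : DifferentiableAt ℝ b x) :
    ∇ (fun y => a y * b y) x = a x • ∇ b x + b x • ∇ a x := by
  simp only [gradient]
  rw [fderiv_fun_mul ha hb]
  simp

theorem gradient_add {a b : Euc n → ℝ} {x : Euc n} (ha : DifferentiableAt ℝ a x)
    (hb : DifferentiableAt ℝ b x) :
    ∇ (fun y => a y + b y) x = ∇ a x + ∇ b x := by
  simp only [gradient]
  rw [fderiv_fun_add ha hb]
  simp

theorem gradient_sub {a b : Euc n → ℝ} {x : Euc n} (ha : DifferentiableAt ℝ a x)
    (hb : DifferentiableAt ℝ b x) :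
    ∇ (fun y => a y - b y) x = ∇ a x - ∇ b x := by
  simp only [gradient]
  rw [fderiv_fun_sub ha hb]
  simp

theorem gradient_const_mul {b : Euc n → ℝ} {x : Euc n} (t : ℝ) (hb : DifferentiableAt ℝ b x) :
    ∇ (fun y => t * b y) x = t • ∇ b x := by
  simp only [gradient]
  rw [fderiv_const_mul hb]
  simp

theorem gradient_real_comp {r : ℝ → ℝ} {b : Euc n → ℝ} {x : Euc n}
    (hr : DifferentiableAt ℝ r (b x)) (hb : DifferentiableAt ℝ b x) :
    ∇ (fun y => r (b y)) x = deriv r (b x) • ∇ b x := by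
  simp only [gradient]
  have := (hr.hasDerivAt.comp_hasFDerivAt x hb.hasFDerivAt).fderiv
  simp only [Function.comp_def] at this
  rw [this]
  simp

theorem gradient_comp_add (a : Euc n → ℝ) (v x : Euc n) :
    ∇ (fun y => a (y + v)) x = ∇ a (x + v) := by
  simp only [gradient]
  rw [fderiv_comp_add_right]

theorem norm_gradient (a : Euc n → ℝ) (x : Euc n) : ‖∇ a x‖ = ‖fderiv ℝ a x‖ := by
  simp [gradient]

theorem continuous_gradient {a : Euc n → ℝ} (ha : ContDiff ℝ 1 a) : Continuous (∇ a) := by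
  have := ha.continuous_fderiv one_ne_zero
  unfold gradient
  fun_prop

/-- A test function: continuously differentiable with compact support. -/
structure IsTest (ψ : Euc n → ℝ) : Prop where
  contDiff : ContDiff ℝ 1 ψ
  compact : HasCompactSupport ψ

namespace IsTest

variable {a b : Euc n → ℝ}

theorem continuous (ha : IsTest a) : Continuous a := ha.contDiff.continuous

theorem differentiableAt (ha : IsTest a) (x : Euc n) : DifferentiableAt ℝ a x :=
  ha.contDiff.differentiable one_ne_zero x

theorem add (ha : IsTest a) (hb : IsTest b) : IsTest fun x => a x + b x :=
  ⟨ha.contDiff.add hb.contDiff, ha.compact.add hb.compact⟩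

theorem mul_left (ha : ContDiff ℝ 1 a) (hb : IsTest b) : IsTest fun x => a x * b x :=
  ⟨ha.mul hb.contDiff, hb.compact.mul_left⟩

theorem const_mul (t : ℝ) (hb : IsTest b) : IsTest fun x => t * b x :=
  mul_left contDiff_const hb

theorem sq (hb : IsTest b) : IsTest fun x => b x ^ 2 := by
  simpa only [pow_two] using mul_left hb.contDiff hb

theorem comp_add (ha : IsTest a) (v : Euc n) : IsTest fun x => a (x + v) :=
  ⟨ha.contDiff.comp (contDiff_id.add contDiff_const),
    ha.compact.comp_homeomorph (Homeomorph.addRight v)⟩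

theorem compact_gradient (ha : IsTest a) : HasCompactSupport (∇ a) := by
  refine (ha.compact.fderiv (𝕜 := ℝ)).mono' ?_
  intro x hx
  refine subset_tsupport _ ?_
  simp only [Function.mem_support, ne_eq, ← norm_eq_zero (E := Euc n), norm_gradient] at hx ⊢
  exact fun h => hx (by rw [h, norm_zero])

theorem continuous_gradient (ha : IsTest a) : Continuous (∇ a) :=
  JumpDiffusion.continuous_gradient ha.contDiff

theorem exists_bound (ha : IsTest a) : ∃ M, ∀ x, |a x| ≤ M :=
  ha.compact.exists_bound_of_continuous ha.continuous

/-- A continuous function multiplied by a test function is integrable. -/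
theorem integrable_mul (hb : IsTest b) (ha : Continuous a) :
    Integrable fun x => a x * b x :=
  (ha.mul hb.continuous).integrable_of_hasCompactSupport hb.compact.mul_left

theorem integrable_inner (hb : IsTest b) (ha : ContDiff ℝ 1 a) :
    Integrable fun x => inner ℝ (∇ a x) (∇ b x) := by
  refine Continuous.integrable_of_hasCompactSupport
    ((JumpDiffusion.continuous_gradient ha).inner hb.continuous_gradient) ?_
  refine hb.compact_gradient.mono fun x hx h => hx ?_
  simp only [h, inner_zero_right]

theorem integrable_mul_norm_sq (hb : IsTest b) (ha : Continuous a) :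
    Integrable fun x => a x * ‖∇ b x‖ ^ 2 := by
  refine Continuous.integrable_of_hasCompactSupport
    (ha.mul (hb.continuous_gradient.norm.pow 2)) ?_
  refine hb.compact_gradient.mono ?_
  intro x hx h
  simp [h] at hx

theorem integrable_norm_sq (hb : IsTest b) : Integrable fun x => ‖∇ b x‖ ^ 2 := by
  simpa using hb.integrable_mul_norm_sq (a := fun _ => 1) continuous_const

theorem exists_support_subset (ha : IsTest a) :
    ∃ R, 0 < R ∧ ∀ x, a x ≠ 0 → x ∈ Metric.closedBall (0 : Euc n) R := by
  obtain ⟨R, hR⟩ := ha.compact.isCompact.isBounded.subset_closedBall (0 : Euc n)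
  refine ⟨max R 1, by positivity, fun x hx => ?_⟩
  exact Metric.closedBall_subset_closedBall (le_max_left _ _) (hR (subset_tsupport _ hx))

end IsTest

/-- A bounded `C¹` function satisfies a Lipschitz bound as soon as one of the points stays in a
fixed ball. -/
theorem exists_lipschitz_from_ball {w : Euc n → ℝ} (hw : ContDiff ℝ 1 w) {M : ℝ}
    (hM : ∀ x, |w x| ≤ M) (R : ℝ) :
    ∃ C, 0 ≤ C ∧ ∀ x ∈ Metric.closedBall (0 : Euc n) R, ∀ y, |w x - w y| ≤ C * ‖x - y‖ := by
  obtain ⟨L, hL⟩ := (hw.contDiffOn (s := Metric.closedBall (0 : Euc n) (R + 1))).exists_lipschitzOnWith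
    one_ne_zero (convex_closedBall _ _) (isCompact_closedBall _ _)
  have hM0 : 0 ≤ M := (abs_nonneg _).trans (hM 0)
  -- `L` serves pairs at distance at most `1`, which stay in the enlarged ball. Beyond that distance
  -- `|w x - w y| ≤ 2M` already suffices.
  refine ⟨L + 2 * M, by positivity, fun x hx y => ?_⟩
  rw [mem_closedBall_zero_iff] at hx
  rcases le_total ‖x - y‖ 1 with h | h
  · have hy : ‖y‖ ≤ R + 1 := by
      have := norm_sub_norm_le y x
      rw [norm_sub_rev] at this; linarith
    have := hL.dist_le_mul x (by rw [mem_closedBall_zero_iff]; linarith) y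
      (by rwa [mem_closedBall_zero_iff])
    rw [Real.dist_eq, dist_eq_norm] at this
    nlinarith [norm_nonneg (x - y)]
  · have h1 := abs_sub (w x) (w y)
    have h2 := hM x
    have h3 := hM y
    have h4 : 0 ≤ (L : ℝ) := L.2
    nlinarith

/-! ### Integrability of the nonlocal energies. -/

section kernel

variable {J : Euc n → ℝ}

theorem integrable_mul_kernel {f k : Euc n → ℝ} (hf : Integrable f) (hk : Integrable k) :
    Integrable fun p : Euc n × Euc n => f p.2 * k (p.1 - p.2) :=
  hf.convolution_integrand (ContinuousLinearMap.mul ℝ ℝ) hk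

theorem integral_mul_kernel {f k : Euc n → ℝ} (hf : Integrable f) (hk : Integrable k) :
    ∫ p : Euc n × Euc n, f p.2 * k (p.1 - p.2) = (∫ x, f x) * ∫ z, k z := by
  have h := integrable_mul_kernel hf hk
  rw [Measure.volume_eq_prod] at h ⊢
  rw [integral_prod_symm _ h]
  simp_rw [integral_const_mul, integral_sub_right_eq_self k, integral_mul_const]

theorem integral_prod_swap_eq (F : Euc n × Euc n → ℝ) :
    ∫ p : Euc n × Euc n, F p.swap = ∫ p, F p := by
  rw [Measure.volume_eq_prod]
  exact integral_prod_swap F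

theorem integrable_prod_swap {F : Euc n × Euc n → ℝ} (h : Integrable F) :
    Integrable fun p : Euc n × Euc n => F p.swap := by
  rw [Measure.volume_eq_prod] at h ⊢
  exact h.swap

/-- The energy form `∬ (a(x) - a(y)) (b(x) - b(y)) J(x - y)`. -/
noncomputable def energy (J a b : Euc n → ℝ) : ℝ :=
  ∫ p : Euc n × Euc n, (a p.1 - a p.2) * (b p.1 - b p.2) * J (p.1 - p.2)

theorem IsJumpKernel.sub_comm (hJ : IsJumpKernel J) (x y : Euc n) : J (x - y) = J (y - x) := by
  rw [← hJ.even, neg_sub]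

theorem IsJumpKernel.measurable_sub (hJ : IsJumpKernel J) :
    Measurable fun p : Euc n × Euc n => J (p.1 - p.2) :=
  hJ.measurable.comp (measurable_fst.sub measurable_snd)

/-- This is the common dominating function for energies in which one factor has compact support: a
pair contributes only if one of its points lies in the ball. Each summand is a convolution integrand
of two integrable functions. -/
theorem integrable_ball_kernel (hJ : IsJumpKernel J)
    (hk : Integrable fun z : Euc n => ‖z‖ ^ 2 * J z) (R : ℝ) :
    Integrable fun p : Euc n × Euc n =>
      ((Metric.closedBall (0 : Euc n) R).indicator 1 p.1 +
        (Metric.closedBall (0 : Euc n) R).indicator 1 p.2) *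
        (‖p.1 - p.2‖ ^ 2 * J (p.1 - p.2)) := by
  have hB : Integrable ((Metric.closedBall (0 : Euc n) R).indicator (1 : Euc n → ℝ)) :=
    (integrable_indicator_iff Metric.isClosed_closedBall.measurableSet).2
      (integrableOn_const (measure_closedBall_lt_top).ne)
  have h1 := integrable_mul_kernel hB hk
  have h2 := integrable_prod_swap h1
  refine (h2.add h1).congr (Eventually.of_forall fun p => ?_)
  simp only [Pi.add_apply, Prod.fst_swap, Prod.snd_swap]
  rw [norm_sub_rev p.2 p.1, hJ.sub_comm p.2 p.1]
  ring

/-- Domination criterion for integrability on the product space. -/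
theorem integrable_of_le_ball_kernel (hJ : IsJumpKernel J)
    (hk : Integrable fun z : Euc n => ‖z‖ ^ 2 * J z) {F : Euc n × Euc n → ℝ} {C R : ℝ}
    (hF : Measurable F)
    (h : ∀ x y, |F (x, y)| ≤ C * ‖x - y‖ ^ 2 * J (x - y))
    (h0 : ∀ x y, x ∉ Metric.closedBall (0 : Euc n) R → y ∉ Metric.closedBall (0 : Euc n) R →
      F (x, y) = 0) : Integrable F := by
  refine Integrable.mono' ((integrable_ball_kernel hJ hk R).const_mul |C|)
    hF.aestronglyMeasurable (Eventually.of_forall ?_)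
  rintro ⟨x, y⟩
  rw [Real.norm_eq_abs]
  have hnn : 0 ≤ ‖x - y‖ ^ 2 * J (x - y) := mul_nonneg (by positivity) (hJ.nonneg _)
  have hb := h x y
  have hC : C * ‖x - y‖ ^ 2 * J (x - y) ≤ |C| * (‖x - y‖ ^ 2 * J (x - y)) := by
    rw [mul_assoc]; gcongr; exact le_abs_self C
  have hnn' := mul_nonneg (abs_nonneg C) hnn
  by_cases hx : x ∈ Metric.closedBall (0 : Euc n) R <;>
  by_cases hy : y ∈ Metric.closedBall (0 : Euc n) R
  · simp only [Set.indicator_of_mem hx, Set.indicator_of_mem hy, Pi.one_apply]; linarith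
  · simp only [Set.indicator_of_mem hx, Set.indicator_of_notMem hy, Pi.one_apply]; linarith
  · simp only [Set.indicator_of_notMem hx, Set.indicator_of_mem hy, Pi.one_apply]; linarith
  · simp [h0 x y hx hy, Set.indicator_of_notMem hx, Set.indicator_of_notMem hy]

theorem integrable_energy (hJ : IsJumpKernel J)
    (hk : Integrable fun z : Euc n => ‖z‖ ^ 2 * J z) {w ψ : Euc n → ℝ} (hw : ContDiff ℝ 1 w)
    (hM : ∃ M, ∀ x, |w x| ≤ M) (hψ : IsTest ψ) :
    Integrable fun p : Euc n × Euc n =>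
      (w p.1 - w p.2) * (ψ p.1 - ψ p.2) * J (p.1 - p.2) := by
  obtain ⟨M, hM⟩ := hM
  obtain ⟨R, -, hR⟩ := hψ.exists_support_subset
  obtain ⟨M', hM'⟩ := hψ.exists_bound
  obtain ⟨C, hC0, hC⟩ := exists_lipschitz_from_ball hw hM R
  obtain ⟨C', hC0', hC'⟩ := exists_lipschitz_from_ball hψ.contDiff hM' R
  have hwc := hw.continuous.measurable
  have hψc := hψ.continuous.measurable
  have h0 : ∀ x y, x ∉ Metric.closedBall (0 : Euc n) R → y ∉ Metric.closedBall (0 : Euc n) R →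
      ψ x - ψ y = 0 := by
    intro x y hx hy
    rw [not_imp_comm.1 (hR x) hx, not_imp_comm.1 (hR y) hy, sub_zero]
  refine integrable_of_le_ball_kernel hJ hk (C := C * C') (R := R) ?_ ?_ ?_
  · exact (((hwc.comp measurable_fst).sub (hwc.comp measurable_snd)).mul
      ((hψc.comp measurable_fst).sub (hψc.comp measurable_snd))).mul hJ.measurable_sub
  · intro x y
    rw [abs_mul, abs_of_nonneg (hJ.nonneg _), abs_mul]
    refine mul_le_mul_of_nonneg_right ?_ (hJ.nonneg _)
    have key : ∀ x y, x ∈ Metric.closedBall (0 : Euc n) R →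
        |w x - w y| * |ψ x - ψ y| ≤ C * C' * ‖x - y‖ ^ 2 := by
      intro x y hx
      calc |w x - w y| * |ψ x - ψ y| ≤ (C * ‖x - y‖) * (C' * ‖x - y‖) :=
            mul_le_mul (hC x hx y) (hC' x hx y) (abs_nonneg _) (by positivity)
        _ = _ := by ring
    by_cases hx : x ∈ Metric.closedBall (0 : Euc n) R
    · exact key x y hx
    by_cases hy : y ∈ Metric.closedBall (0 : Euc n) R
    · rw [abs_sub_comm, abs_sub_comm (ψ x), norm_sub_rev]; exact key y x hy
    · rw [h0 x y hx hy]; simp only [abs_zero, mul_zero]; positivity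
  · intro x y hx hy
    simp [h0 x y hx hy]

theorem IsTest.integrable_energy (hJ : IsJumpKernel J)
    (hk : Integrable fun z : Euc n => ‖z‖ ^ 2 * J z) {a b : Euc n → ℝ} (ha : IsTest a)
    (hb : IsTest b) : Integrable fun p : Euc n × Euc n =>
      (a p.1 - a p.2) * (b p.1 - b p.2) * J (p.1 - p.2) :=
  JumpDiffusion.integrable_energy hJ hk ha.contDiff ha.exists_bound hb

theorem integrable_weight_energy (hJ : IsJumpKernel J)
    (hk : Integrable fun z : Euc n => ‖z‖ ^ 2 * J z) {w η : Euc n → ℝ} (hw : Continuous w)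
    (hM : ∃ M, ∀ x, |w x| ≤ M) (hη : IsTest η) :
    Integrable fun p : Euc n × Euc n =>
      w p.1 * w p.2 * (η p.1 - η p.2) ^ 2 * J (p.1 - p.2) := by
  obtain ⟨M, hM⟩ := hM
  have h := hη.integrable_energy hJ hk hη
  have hb := h.bdd_mul (c := M * M) (f := fun p : Euc n × Euc n => w p.1 * w p.2)
    (by fun_prop) (Eventually.of_forall fun p => ?_)
  · refine hb.congr (Eventually.of_forall fun p => ?_)
    simp only
    ring
  · rw [Real.norm_eq_abs, abs_mul]
    exact mul_le_mul (hM _) (hM _) (abs_nonneg _) ((abs_nonneg _).trans (hM p.1))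

end kernel

end JumpDiffusion

/-! ### Weak formulation, Caccioppoli identity, second differences. -/

namespace JumpDiffusion

variable {n : ℕ} {J : Euc n → ℝ} {c : ℝ}

/-- Weak formulation of `-Δw - c L[w] = g`. -/
def IsWeakSolution (J : Euc n → ℝ) (c : ℝ) (w g : Euc n → ℝ) : Prop :=
  ∀ ψ : Euc n → ℝ, IsTest ψ →
    (∫ x, inner ℝ (∇ w x) (∇ ψ x)) + c / 2 * energy J w ψ = ∫ x, g x * ψ x

/-- Testing the equation of `w` with `w η²`. -/
theorem IsWeakSolution.energy_identity (hJ : IsJumpKernel J)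
    (hk : Integrable fun z : Euc n => ‖z‖ ^ 2 * J z) {w g η : Euc n → ℝ}
    (h : IsWeakSolution J c w g) (hw : ContDiff ℝ 1 w) (hM : ∃ M, ∀ x, |w x| ≤ M)
    (hη : IsTest η) :
    (∫ x, ‖∇ (fun y => w y * η y) x‖ ^ 2) +
        c / 2 * energy J (fun y => w y * η y) (fun y => w y * η y) =
      (∫ x, w x ^ 2 * ‖∇ η x‖ ^ 2) +
        c / 2 * (∫ p : Euc n × Euc n, w p.1 * w p.2 * (η p.1 - η p.2) ^ 2 * J (p.1 - p.2)) +
        ∫ x, g x * (w x * η x ^ 2) := by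
  have hwη : IsTest fun x => w x * η x := IsTest.mul_left hw hη
  have hψ : IsTest fun x => w x * η x ^ 2 := IsTest.mul_left hw hη.sq
  have hloc : ∫ x, inner ℝ (∇ w x) (∇ (fun y => w y * η y ^ 2) x) =
      (∫ x, ‖∇ (fun y => w y * η y) x‖ ^ 2) - ∫ x, w x ^ 2 * ‖∇ η x‖ ^ 2 := by
    have hw2 : Continuous fun x => w x ^ 2 := hw.continuous.pow 2
    rw [← integral_sub hwη.integrable_norm_sq (hη.integrable_mul_norm_sq hw2)]
    refine integral_congr_ae (Eventually.of_forall fun x => ?_)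
    have hwx : DifferentiableAt ℝ w x := hw.differentiable one_ne_zero x
    have hηx := hη.differentiableAt x
    have h1 : ∇ (fun y => η y ^ 2) x = (2 * η x) • ∇ η x := by
      simp only [pow_two]
      rw [gradient_mul hηx hηx]
      module
    simp only
    rw [gradient_mul hwx (hη.sq.differentiableAt x), gradient_mul hwx hηx, h1,
      ← real_inner_self_eq_norm_sq, ← real_inner_self_eq_norm_sq]
    simp only [inner_add_left, inner_add_right, real_inner_smul_left, real_inner_smul_right]
    rw [real_inner_comm (∇ w x) (∇ η x)]
    ring
  -- Discrete analogue of the local identity: `(a - b)(a x² - b y²) = (a x - b y)² - a b (x - y)²`.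
  have hnonloc : energy J w (fun y => w y * η y ^ 2) =
      energy J (fun y => w y * η y) (fun y => w y * η y) -
        ∫ p : Euc n × Euc n, w p.1 * w p.2 * (η p.1 - η p.2) ^ 2 * J (p.1 - p.2) := by
    unfold energy
    rw [← integral_sub (hwη.integrable_energy hJ hk hwη)
      (integrable_weight_energy hJ hk hw.continuous hM hη)]
    refine integral_congr_ae (Eventually.of_forall fun p => ?_)
    simp only
    ring
  have := h _ hψ
  rw [hloc, hnonloc] at this
  linarith

theorem integral_laplacian_mul {u ψ : Euc n → ℝ} (hu : ContDiff ℝ 2 u) (hψ : IsTest ψ) :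
    ∫ x, Laplacian.laplacian u x * ψ x = -∫ x, inner ℝ (∇ u x) (∇ ψ x) := by
  let e := EuclideanSpace.basisFun (Fin n) ℝ
  have hu1 : ContDiff ℝ 1 u := hu.of_le (by norm_num)
  have hdu : ContDiff ℝ 1 (fderiv ℝ u) := hu.fderiv_right (by norm_num)
  have hdi : ∀ i, ContDiff ℝ 1 fun x => fderiv ℝ u x (e i) := fun i => hdu.clm_apply contDiff_const
  have hL : ∀ x, Laplacian.laplacian u x =
      ∑ i, fderiv ℝ (fun y => fderiv ℝ u y (e i)) x (e i) := by
    intro x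
    rw [InnerProductSpace.laplacian_eq_iteratedFDeriv_orthonormalBasis u e]
    refine Finset.sum_congr rfl fun i _ => ?_
    rw [iteratedFDeriv_two_apply]
    have := ((hdu.differentiable one_ne_zero x).hasFDerivAt.clm_apply
      (hasFDerivAt_const (e i) x)).fderiv
    rw [this]
    simp
  have hI : ∀ x, inner ℝ (∇ u x) (∇ ψ x) = ∑ i, fderiv ℝ u x (e i) * fderiv ℝ ψ x (e i) := by
    intro x
    rw [← e.sum_inner_mul_inner]
    refine Finset.sum_congr rfl fun i _ => ?_
    rw [inner_gradient_left, real_inner_comm, inner_gradient_left]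
  have hc1 : ∀ i, Continuous fun x => fderiv ℝ (fun y => fderiv ℝ u y (e i)) x (e i) := fun i =>
    ((hdi i).continuous_fderiv one_ne_zero).clm_apply continuous_const
  have hi1 : ∀ i, Integrable fun x => fderiv ℝ (fun y => fderiv ℝ u y (e i)) x (e i) * ψ x :=
    fun i => hψ.integrable_mul (hc1 i)
  have hc2 : ∀ i, Continuous fun x => fderiv ℝ ψ x (e i) := fun i =>
    (hψ.contDiff.continuous_fderiv one_ne_zero).clm_apply continuous_const
  have hi2 : ∀ i, Integrable fun x => fderiv ℝ u x (e i) * fderiv ℝ ψ x (e i) := fun i =>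
    ((hdi i).continuous.mul (hc2 i)).integrable_of_hasCompactSupport
      (hψ.compact.fderiv_apply (𝕜 := ℝ) (e i)).mul_left
  simp_rw [hL, hI, Finset.sum_mul]
  rw [integral_finsetSum _ fun i _ => hi1 i, integral_finsetSum _ fun i _ => hi2 i,
    ← Finset.sum_neg_distrib]
  refine Finset.sum_congr rfl fun i _ => ?_
  rw [integral_mul_fderiv_eq_neg_fderiv_mul_of_integrable (hi1 i) (hi2 i)
    (hψ.integrable_mul (hdi i).continuous)
    (fun x _ => (hdi i).differentiable one_ne_zero x) (fun x _ => hψ.differentiableAt x), neg_neg]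

/-- Symmetric second differences of a bounded `C²` function are quadratically small, locally
uniformly in the base point. -/
theorem exists_second_difference_bound {u : Euc n → ℝ} (hu : ContDiff ℝ 2 u) {M : ℝ}
    (hM : ∀ x, |u x| ≤ M) (R : ℝ) :
    ∃ C, 0 ≤ C ∧ ∀ x ∈ Metric.closedBall (0 : Euc n) R, ∀ z,
      |u (x + z) + u (x - z) - 2 * u x| ≤ C * ‖z‖ ^ 2 := by
  have hdu : ContDiff ℝ 1 (fderiv ℝ u) := hu.fderiv_right (by norm_num)
  have hd : Differentiable ℝ u := hu.differentiable (by norm_num)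
  obtain ⟨L, hL⟩ := (hdu.contDiffOn
    (s := Metric.closedBall (0 : Euc n) (R + 1))).exists_lipschitzOnWith
    one_ne_zero (convex_closedBall _ _) (isCompact_closedBall _ _)
  have hM0 : 0 ≤ M := (abs_nonneg _).trans (hM 0)
  have hL0 : 0 ≤ (L : ℝ) := L.2
  refine ⟨2 * L + 4 * M, by positivity, fun x hx z => ?_⟩
  rw [mem_closedBall_zero_iff] at hx
  rcases le_total ‖z‖ 1 with h | h
  -- The second difference is `φ 1 - φ 0`, and `φ'` compares the derivative of `u` at two points at
  -- distance at most `2‖z‖`, so the Lipschitz bound on `fderiv ℝ u` yields `2L‖z‖²`.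
  · let φ : ℝ → ℝ := fun t => u (x + t • z) + u (x - t • z)
    have hφ : ∀ t, HasDerivAt φ (fderiv ℝ u (x + t • z) z - fderiv ℝ u (x - t • z) z) t := by
      intro t
      have h1 : HasDerivAt (fun t : ℝ => x + t • z) z t := by
        simpa using ((hasDerivAt_id t).smul_const z).const_add x
      have h2 : HasDerivAt (fun t : ℝ => x - t • z) (-z) t := by
        simpa using ((hasDerivAt_id t).smul_const z).const_sub x
      have h3 := (hd (x + t • z)).hasFDerivAt.comp_hasDerivAt t h1
      have h4 := (hd (x - t • z)).hasFDerivAt.comp_hasDerivAt t h2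
      exact (h3.add h4).congr_deriv (by simp [sub_eq_add_neg])
    have hbd : ∀ t ∈ Set.Icc (0 : ℝ) 1,
        ‖fderiv ℝ u (x + t • z) z - fderiv ℝ u (x - t • z) z‖ ≤ 2 * L * ‖z‖ ^ 2 := by
      intro t ht
      have htz : ‖t • z‖ ≤ ‖z‖ := by
        rw [norm_smul, Real.norm_eq_abs, abs_of_nonneg ht.1]
        exact mul_le_of_le_one_left (norm_nonneg _) ht.2
      have h1 : x + t • z ∈ Metric.closedBall (0 : Euc n) (R + 1) := by
        rw [mem_closedBall_zero_iff]; linarith [norm_add_le x (t • z)]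
      have h2 : x - t • z ∈ Metric.closedBall (0 : Euc n) (R + 1) := by
        rw [mem_closedBall_zero_iff]; linarith [norm_sub_le x (t • z)]
      have h3 := hL.dist_le_mul _ h1 _ h2
      rw [dist_eq_norm, dist_eq_norm] at h3
      have h4 : ‖x + t • z - (x - t • z)‖ ≤ 2 * ‖z‖ := by
        have : x + t • z - (x - t • z) = t • z + t • z := by abel
        rw [this]; linarith [norm_add_le (t • z) (t • z)]
      rw [← sub_apply]
      calc _ ≤ ‖fderiv ℝ u (x + t • z) - fderiv ℝ u (x - t • z)‖ * ‖z‖ :=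
            ContinuousLinearMap.le_opNorm _ _
        _ ≤ (L * (2 * ‖z‖)) * ‖z‖ := by
            gcongr; exact h3.trans (by gcongr)
        _ = _ := by ring
    have := (convex_Icc (0 : ℝ) 1).norm_image_sub_le_of_norm_hasDerivWithin_le
      (fun t ht => (hφ t).hasDerivWithinAt) hbd (x := 0) (y := 1) (by simp) (by simp)
    simp only [φ, one_smul, zero_smul, add_zero, sub_zero, Real.norm_eq_abs, abs_one, mul_one]
      at this
    have e : u (x + z) + u (x - z) - 2 * u x = u (x + z) + u (x - z) - (u x + u x) := by ring
    rw [e]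
    nlinarith [sq_nonneg ‖z‖]
  · have h1 := abs_le.1 (hM (x + z))
    have h2 := abs_le.1 (hM (x - z))
    have h3 := abs_le.1 (hM x)
    have : |u (x + z) + u (x - z) - 2 * u x| ≤ 4 * M := by
      rw [abs_le]; constructor <;> linarith [h1.1, h1.2, h2.1, h2.2, h3.1, h3.2]
    nlinarith [mul_nonneg hL0 (sq_nonneg ‖z‖), one_le_pow₀ (n := 2) h]

end JumpDiffusion

/-! ### From classical to weak solutions. -/

namespace JumpDiffusion

variable {n : ℕ} {J : Euc n → ℝ} {c : ℝ}

/-- The kernel `J` cut off at distance `ε` from the origin. -/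
noncomputable def truncKernel (J : Euc n → ℝ) (ε : ℝ) : Euc n → ℝ :=
  {z : Euc n | ε < ‖z‖}.indicator J

theorem measurableSet_norm_gt (ε : ℝ) : MeasurableSet {z : Euc n | ε < ‖z‖} :=
  (isOpen_lt continuous_const continuous_norm).measurableSet

theorem truncKernel_nonneg (hJ : IsJumpKernel J) (ε : ℝ) (z : Euc n) : 0 ≤ truncKernel J ε z :=
  Set.indicator_nonneg (fun z _ => hJ.nonneg z) z

theorem truncKernel_le (hJ : IsJumpKernel J) (ε : ℝ) (z : Euc n) : truncKernel J ε z ≤ J z :=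
  Set.indicator_le_self' (fun _ _ => hJ.nonneg _) z

theorem truncKernel_neg (hJ : IsJumpKernel J) (ε : ℝ) (z : Euc n) :
    truncKernel J ε (-z) = truncKernel J ε z := by
  simp [truncKernel, Set.indicator, hJ.even]

theorem measurable_truncKernel (hJ : IsJumpKernel J) (ε : ℝ) : Measurable (truncKernel J ε) :=
  hJ.measurable.indicator (measurableSet_norm_gt ε)

theorem integrable_truncKernel (hJ : IsJumpKernel J)
    (hk : Integrable fun z : Euc n => ‖z‖ ^ 2 * J z) {ε : ℝ} (hε : 0 < ε) :
    Integrable (truncKernel J ε) := by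
  refine Integrable.mono' (hk.const_mul (ε ^ 2)⁻¹) (measurable_truncKernel hJ ε).aestronglyMeasurable
    (Eventually.of_forall fun z => ?_)
  rw [Real.norm_of_nonneg (truncKernel_nonneg hJ ε z)]
  have h0 := hJ.nonneg z
  by_cases hz : z ∈ {z : Euc n | ε < ‖z‖}
  · rw [truncKernel, Set.indicator_of_mem hz, ← mul_assoc]
    refine le_mul_of_one_le_left h0 ?_
    rw [inv_mul_eq_div, one_le_div (by positivity)]
    have : ε < ‖z‖ := hz
    gcongr
  · rw [truncKernel, Set.indicator_of_notMem hz]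
    positivity

theorem tendsto_truncKernel {z : Euc n} (hz : z ≠ 0) :
    Tendsto (fun ε => truncKernel J ε z) (𝓝[>] 0) (𝓝 (J z)) := by
  refine tendsto_const_nhds.congr' ?_
  have : ∀ᶠ ε in 𝓝[>] (0 : ℝ), ε < ‖z‖ :=
    nhdsWithin_le_nhds (eventually_lt_nhds (norm_pos_iff.2 hz))
  filter_upwards [this] with ε hε
  exact (Set.indicator_of_mem (s := {z : Euc n | ε < ‖z‖}) hε J).symm

theorem setIntegral_truncation (J u : Euc n → ℝ) (x : Euc n) (ε : ℝ) :
    ∫ y in {y | ε < ‖x - y‖}, (u y - u x) * J (x - y) =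
      ∫ y, (u y - u x) * truncKernel J ε (x - y) := by
  rw [← integral_indicator]
  · refine integral_congr_ae (Eventually.of_forall fun y => ?_)
    by_cases hy : ε < ‖x - y‖ <;> simp [truncKernel, Set.indicator, hy]
  · exact (isOpen_lt continuous_const (by fun_prop)).measurableSet

/-- Evenness of `J` allows averaging over `z` and `-z`. First differences become second differences,
which compensate the singularity of `J`. The bound does not depend on `ε`, as dominated convergence
requires. -/
theorem abs_truncation_le (hJ : IsJumpKernel J)
    (hk : Integrable fun z : Euc n => ‖z‖ ^ 2 * J z) {u : Euc n → ℝ} (hu : Continuous u) {M : ℝ}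
    (hM : ∀ x, |u x| ≤ M) {C : ℝ} (hC : 0 ≤ C) {x : Euc n}
    (h : ∀ z, |u (x + z) + u (x - z) - 2 * u x| ≤ C * ‖z‖ ^ 2) {ε : ℝ} (hε : 0 < ε) :
    |∫ y, (u y - u x) * truncKernel J ε (x - y)| ≤ C / 2 * ∫ z, ‖z‖ ^ 2 * J z := by
  have hT := integrable_truncKernel hJ hk hε
  have e1 : ∫ y, (u y - u x) * truncKernel J ε (x - y) =
      ∫ z, (u (x - z) - u x) * truncKernel J ε z := by
    rw [← integral_sub_left_eq_self (fun y => (u y - u x) * truncKernel J ε (x - y)) volume x]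
    simp
  have e2 : ∫ z, (u (x - z) - u x) * truncKernel J ε z =
      ∫ z, (u (x + z) - u x) * truncKernel J ε z := by
    rw [← integral_neg_eq_self]
    simp [truncKernel_neg hJ]
  have hbd : ∀ y, |u y - u x| ≤ 2 * M := fun y => by
    linarith [abs_sub (u y) (u x), hM x, hM y]
  have i1 : Integrable fun z => (u (x - z) - u x) * truncKernel J ε z :=
    hT.bdd_mul (c := 2 * M) (by fun_prop) (Eventually.of_forall fun z => hbd _)
  have i2 : Integrable fun z => (u (x + z) - u x) * truncKernel J ε z :=
    hT.bdd_mul (c := 2 * M) (by fun_prop) (Eventually.of_forall fun z => hbd _)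
  have e3 : ∫ y, (u y - u x) * truncKernel J ε (x - y) =
      1 / 2 * ∫ z, (u (x + z) + u (x - z) - 2 * u x) * truncKernel J ε z := by
    have : ∫ z, (u (x + z) + u (x - z) - 2 * u x) * truncKernel J ε z =
        (∫ z, (u (x + z) - u x) * truncKernel J ε z) +
          ∫ z, (u (x - z) - u x) * truncKernel J ε z := by
      rw [← integral_add i2 i1]
      refine integral_congr_ae (Eventually.of_forall fun z => ?_)
      simp only
      ring
    rw [this, e1, e2]
    ring
  rw [e3, abs_mul, abs_of_nonneg (by norm_num : (0 : ℝ) ≤ 1 / 2)]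
  have : |∫ z, (u (x + z) + u (x - z) - 2 * u x) * truncKernel J ε z| ≤
      ∫ z, C * (‖z‖ ^ 2 * J z) := by
    rw [← Real.norm_eq_abs]
    refine norm_integral_le_of_norm_le (hk.const_mul C) (Eventually.of_forall fun z => ?_)
    rw [Real.norm_eq_abs, abs_mul, abs_of_nonneg (truncKernel_nonneg hJ ε z), ← mul_assoc]
    exact mul_le_mul (h z) (truncKernel_le hJ ε z) (truncKernel_nonneg hJ ε z) (by positivity)
  rw [integral_const_mul] at this
  linarith

/-- The truncated operator is symmetric. -/
theorem integral_mul_truncation (hJ : IsJumpKernel J)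
    (hk : Integrable fun z : Euc n => ‖z‖ ^ 2 * J z) {u ψ : Euc n → ℝ} (hu : Continuous u) {M : ℝ}
    (hM : ∀ x, |u x| ≤ M) (hψ : IsTest ψ) {ε : ℝ} (hε : 0 < ε) :
    Integrable (fun x => ψ x * ∫ y, (u y - u x) * truncKernel J ε (x - y)) ∧
    ∫ x, ψ x * ∫ y, (u y - u x) * truncKernel J ε (x - y) =
      -(1 / 2) * ∫ p : Euc n × Euc n,
        (u p.1 - u p.2) * (ψ p.1 - ψ p.2) * truncKernel J ε (p.1 - p.2) := by
  have hT := integrable_truncKernel hJ hk hε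
  have hψi : Integrable ψ := hψ.continuous.integrable_of_hasCompactSupport hψ.compact
  have hbd : ∀ x y, |u y - u x| ≤ 2 * M := fun x y => by
    linarith [abs_sub (u y) (u x), hM x, hM y]
  have hsymm : ∀ x y : Euc n, truncKernel J ε (x - y) = truncKernel J ε (y - x) := fun x y => by
    rw [← truncKernel_neg hJ, neg_sub]
  let F : Euc n × Euc n → ℝ := fun p => (u p.2 - u p.1) * (ψ p.1 * truncKernel J ε (p.1 - p.2))
  -- Only after truncation is the kernel integrable, so that the two terms of the symmetrization can
  -- be separated and Fubini applied.
  have hF : Integrable F := by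
    refine Integrable.bdd_mul (c := 2 * M) ?_ (by fun_prop) (Eventually.of_forall fun p => hbd _ _)
    refine (integrable_prod_swap (integrable_mul_kernel hψi hT)).congr
      (Eventually.of_forall fun p => ?_)
    simp only [Prod.fst_swap, Prod.snd_swap]
    rw [hsymm]
  have hF' := hF
  rw [Measure.volume_eq_prod] at hF'
  have e1 : ∀ x, ψ x * ∫ y, (u y - u x) * truncKernel J ε (x - y) = ∫ y, F (x, y) := by
    intro x
    rw [← integral_const_mul]
    refine integral_congr_ae (Eventually.of_forall fun y => ?_)
    simp only [F]
    ring
  simp_rw [e1]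
  refine ⟨hF'.integral_prod_left, ?_⟩
  rw [← integral_prod _ hF', ← Measure.volume_eq_prod]
  have e2 : ∫ p : Euc n × Euc n, (u p.1 - u p.2) * (ψ p.1 - ψ p.2) * truncKernel J ε (p.1 - p.2) =
      -((∫ p, F p) + ∫ p : Euc n × Euc n, F p.swap) := by
    rw [← integral_add hF (integrable_prod_swap hF), ← integral_neg]
    refine integral_congr_ae (Eventually.of_forall fun p => ?_)
    simp only [F, Prod.fst_swap, Prod.snd_swap]
    rw [hsymm p.2 p.1]
    ring
  rw [e2, integral_prod_swap_eq]
  ring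

/-- For each `ε` the truncated operator is symmetric, so both sides can be passed to the limit: the
pointwise side through the uniform second-difference bound on the support of `ψ`, the energy side
through domination by the full energy integrand. -/
theorem IsSolution.isWeakSolution (hJ : IsJumpKernel J)
    (hk : Integrable fun z : Euc n => ‖z‖ ^ 2 * J z) {f : ℝ → ℝ} (hf : Continuous f)
    {u : Euc n → ℝ} (hM : ∃ M, ∀ x, |u x| ≤ M) (h : IsSolution J c f u) :
    IsWeakSolution J c u fun x => f (u x) := by
  obtain ⟨hu, h⟩ := h
  choose ℓ hℓ heq using h
  intro ψ hψ
  have hu1 : ContDiff ℝ 1 u := hu.of_le (by norm_num)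
  obtain ⟨R, -, hR⟩ := hψ.exists_support_subset
  have hI := integrable_energy hJ hk hu1 hM hψ
  obtain ⟨M, hM⟩ := hM
  obtain ⟨C, hC0, hC⟩ := exists_second_difference_bound hu hM R
  have hψi : Integrable ψ := hψ.continuous.integrable_of_hasCompactSupport hψ.compact
  have hpos : ∀ᶠ ε in 𝓝[>] (0 : ℝ), 0 < ε := eventually_mem_nhdsWithin
  have t1 : Tendsto (fun ε => ∫ x, ψ x * ∫ y, (u y - u x) * truncKernel J ε (x - y)) (𝓝[>] 0)
      (𝓝 (∫ x, ψ x * ℓ x)) := by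
    refine tendsto_integral_filter_of_dominated_convergence
      (fun x => |ψ x| * (C / 2 * ∫ z, ‖z‖ ^ 2 * J z)) ?_ ?_ (hψi.abs.mul_const _) ?_
    · filter_upwards [hpos] with ε hε
      exact (integral_mul_truncation hJ hk hu.continuous hM hψ hε).1.aestronglyMeasurable
    · filter_upwards [hpos] with ε hε
      refine Eventually.of_forall fun x => ?_
      rw [Real.norm_eq_abs, abs_mul]
      by_cases hx : ψ x = 0
      · simp [hx]
      · exact mul_le_mul_of_nonneg_left
          (abs_truncation_le hJ hk hu.continuous hM hC0 (hC x (hR x hx)) hε) (abs_nonneg _)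
    · refine Eventually.of_forall fun x => ?_
      have := (hℓ x).2
      simp_rw [setIntegral_truncation] at this
      exact this.const_mul _
  have t2 : Tendsto (fun ε => ∫ p : Euc n × Euc n,
      (u p.1 - u p.2) * (ψ p.1 - ψ p.2) * truncKernel J ε (p.1 - p.2)) (𝓝[>] 0)
      (𝓝 (energy J u ψ)) := by
    have hum := hu.continuous.measurable
    have hψm := hψ.continuous.measurable
    refine tendsto_integral_filter_of_dominated_convergence _ ?_ ?_ hI.norm ?_
    · refine Eventually.of_forall fun ε => Measurable.aestronglyMeasurable ?_
      exact (((hum.comp measurable_fst).sub (hum.comp measurable_snd)).mul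
        ((hψm.comp measurable_fst).sub (hψm.comp measurable_snd))).mul
        ((measurable_truncKernel hJ ε).comp (measurable_fst.sub measurable_snd))
    · refine Eventually.of_forall fun ε => Eventually.of_forall fun p => ?_
      rw [norm_mul, norm_mul _ (J _), Real.norm_of_nonneg (truncKernel_nonneg hJ ε _),
        Real.norm_of_nonneg (hJ.nonneg _)]
      exact mul_le_mul_of_nonneg_left (truncKernel_le hJ ε _) (norm_nonneg _)
    · refine Eventually.of_forall fun p => ?_
      by_cases hp : p.1 - p.2 = 0
      · rw [sub_eq_zero.1 hp]; simp
      · exact (tendsto_truncKernel hp).const_mul _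
  have e1 : ∫ x, ψ x * ℓ x = -(1 / 2) * energy J u ψ := by
    refine tendsto_nhds_unique t1 ((t2.const_mul (-(1 / 2))).congr' ?_)
    filter_upwards [hpos] with ε hε
    exact (integral_mul_truncation hJ hk hu.continuous hM hψ hε).2.symm
  have e2 := integral_laplacian_mul hu hψ
  have hfu : Integrable fun x => f (u x) * ψ x := hψ.integrable_mul (hf.comp hu.continuous)
  have hΔ : Integrable fun x => Laplacian.laplacian u x * ψ x := by
    refine hψ.integrable_mul ?_
    rw [InnerProductSpace.laplacian_eq_iteratedFDeriv_stdOrthonormalBasis]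
    refine continuous_finsetSum _ fun i _ => ?_
    have := hu.continuous_iteratedFDeriv (m := 2) (by norm_num)
    fun_prop
  have e3 : c * ∫ x, ψ x * ℓ x =
      -((∫ x, Laplacian.laplacian u x * ψ x) + ∫ x, f (u x) * ψ x) := by
    rw [← integral_add hΔ hfu, ← integral_neg, ← integral_const_mul]
    refine integral_congr_ae (Eventually.of_forall fun x => ?_)
    simp only
    linear_combination ψ x * heq x
  rw [e1, e2] at e3
  linear_combination -e3

end JumpDiffusion

/-! ### Caccioppoli estimate and difference quotients. -/

namespace JumpDiffusion

variable {n : ℕ} {J : Euc n → ℝ} {c : ℝ}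

theorem energy_comp_add (J a b : Euc n → ℝ) (v : Euc n) :
    energy J (fun x => a (x + v)) (fun x => b (x + v)) = energy J a b := by
  unfold energy
  rw [Measure.volume_eq_prod, ← integral_add_right_eq_self (fun p : Euc n × Euc n =>
    (a p.1 - a p.2) * (b p.1 - b p.2) * J (p.1 - p.2)) (v, v)]
  simp

theorem energy_self_nonneg (hJ : IsJumpKernel J) (a : Euc n → ℝ) : 0 ≤ energy J a a :=
  integral_nonneg fun _ => mul_nonneg (mul_self_nonneg _) (hJ.nonneg _)

theorem IsWeakSolution.comp_add {w g : Euc n → ℝ} (h : IsWeakSolution J c w g) (v : Euc n) :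
    IsWeakSolution J c (fun x => w (x + v)) (fun x => g (x + v)) := by
  intro ψ hψ
  have := h _ (hψ.comp_add (-v))
  rw [← energy_comp_add J w _ v,
    ← integral_add_right_eq_self (fun x => inner ℝ (∇ w x) (∇ (fun y => ψ (y + -v)) x)) v,
    ← integral_add_right_eq_self (fun x => g x * ψ (x + -v)) v] at this
  simp_rw [gradient_comp_add] at this ⊢
  simpa using this

theorem IsWeakSolution.smul_sub (hJ : IsJumpKernel J)
    (hk : Integrable fun z : Euc n => ‖z‖ ^ 2 * J z) {w₁ w₂ g₁ g₂ : Euc n → ℝ}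
    (h₁ : IsWeakSolution J c w₁ g₁) (h₂ : IsWeakSolution J c w₂ g₂)
    (hw₁ : ContDiff ℝ 1 w₁) (hw₂ : ContDiff ℝ 1 w₂) (hM₁ : ∃ M, ∀ x, |w₁ x| ≤ M)
    (hM₂ : ∃ M, ∀ x, |w₂ x| ≤ M) (hg₁ : Continuous g₁) (hg₂ : Continuous g₂) (t : ℝ) :
    IsWeakSolution J c (fun x => t * (w₁ x - w₂ x)) (fun x => t * (g₁ x - g₂ x)) := by
  intro ψ hψ
  have e1 : ∫ x, inner ℝ (∇ (fun x => t * (w₁ x - w₂ x)) x) (∇ ψ x) =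
      t * ((∫ x, inner ℝ (∇ w₁ x) (∇ ψ x)) - ∫ x, inner ℝ (∇ w₂ x) (∇ ψ x)) := by
    rw [← integral_sub (hψ.integrable_inner hw₁) (hψ.integrable_inner hw₂), ← integral_const_mul]
    refine integral_congr_ae (Eventually.of_forall fun x => ?_)
    have d₁ := hw₁.differentiable one_ne_zero x
    have d₂ := hw₂.differentiable one_ne_zero x
    simp only
    rw [gradient_const_mul t (d₁.fun_sub d₂), gradient_sub d₁ d₂, real_inner_smul_left, inner_sub_left]
  have e2 : energy J (fun x => t * (w₁ x - w₂ x)) ψ = t * (energy J w₁ ψ - energy J w₂ ψ) := by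
    unfold energy
    rw [← integral_sub (integrable_energy hJ hk hw₁ hM₁ hψ) (integrable_energy hJ hk hw₂ hM₂ hψ),
      ← integral_const_mul]
    refine integral_congr_ae (Eventually.of_forall fun p => ?_)
    simp only
    ring
  have e3 : ∫ x, t * (g₁ x - g₂ x) * ψ x = t * ((∫ x, g₁ x * ψ x) - ∫ x, g₂ x * ψ x) := by
    rw [← integral_sub (hψ.integrable_mul hg₁) (hψ.integrable_mul hg₂), ← integral_const_mul]
    refine integral_congr_ae (Eventually.of_forall fun x => ?_)
    simp only
    ring
  rw [e1, e2, e3, ← h₁ ψ hψ, ← h₂ ψ hψ]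
  ring

/-- Caccioppoli estimate: the gradient of a bounded weak solution is uniformly locally square
integrable. -/
theorem IsWeakSolution.exists_gradient_bound (hJ : IsJumpKernel J)
    (hk : Integrable fun z : Euc n => ‖z‖ ^ 2 * J z) (hc : 0 ≤ c) {w g : Euc n → ℝ}
    (h : IsWeakSolution J c w g) (hw : ContDiff ℝ 1 w) {M F : ℝ} (hM : ∀ x, |w x| ≤ M)
    (hg : Continuous g) (hF : ∀ x, |g x| ≤ F) :
    ∃ K, ∀ a, ∫ x in Metric.closedBall a 1, ‖∇ w x‖ ^ 2 ≤ K := by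
  have hM0 : 0 ≤ M := (abs_nonneg _).trans (hM 0)
  -- With inner radius `2`, the translated bump is `1` on a neighbourhood of the closed unit ball,
  -- so `w` and `w η` have the same gradient there. Translation invariance of all the integrals of
  -- `χ` makes the constant independent of the centre.
  let b : ContDiffBump (0 : Euc n) := ⟨2, 3, by norm_num, by norm_num⟩
  let χ : Euc n → ℝ := b
  have hχ : IsTest χ := ⟨b.contDiff, b.hasCompactSupport⟩
  refine ⟨M ^ 2 * (∫ x, ‖∇ χ x‖ ^ 2) + c / 2 * (M ^ 2 * energy J χ χ) +
    F * M * ∫ x, χ x ^ 2, fun a => ?_⟩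
  let η : Euc n → ℝ := fun x => χ (x + -a)
  have hη : IsTest η := hχ.comp_add (-a)
  have hwη : IsTest fun x => w x * η x := IsTest.mul_left hw hη
  have hid := h.energy_identity hJ hk hw ⟨M, hM⟩ hη
  have hE := mul_nonneg (by positivity : 0 ≤ c / 2) (energy_self_nonneg hJ fun y => w y * η y)
  have hw2 : Continuous fun x => w x ^ 2 := hw.continuous.pow 2
  have hwb : ∀ x, w x ^ 2 ≤ M ^ 2 := fun x => sq_le_sq' (neg_le_of_abs_le (hM x))
    (le_of_abs_le (hM x))
  have b1 : ∫ x, w x ^ 2 * ‖∇ η x‖ ^ 2 ≤ M ^ 2 * ∫ x, ‖∇ χ x‖ ^ 2 := by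
    have : ∫ x, ‖∇ χ x‖ ^ 2 = ∫ x, ‖∇ η x‖ ^ 2 := by
      rw [← integral_add_right_eq_self (fun x => ‖∇ χ x‖ ^ 2) (-a)]
      simp_rw [η, gradient_comp_add]
    rw [this, ← integral_const_mul]
    exact integral_mono (hη.integrable_mul_norm_sq hw2) (hη.integrable_norm_sq.const_mul _)
      fun x => mul_le_mul_of_nonneg_right (hwb x) (by positivity)
  have b2 : ∫ p : Euc n × Euc n, w p.1 * w p.2 * (η p.1 - η p.2) ^ 2 * J (p.1 - p.2) ≤
      M ^ 2 * energy J χ χ := by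
    rw [← energy_comp_add J χ χ (-a), energy, ← integral_const_mul]
    refine integral_mono (integrable_weight_energy hJ hk hw.continuous ⟨M, hM⟩ hη)
      ((hη.integrable_energy hJ hk hη).const_mul _) fun p => ?_
    have h1 : w p.1 * w p.2 ≤ M ^ 2 := by nlinarith [hwb p.1, hwb p.2, sq_nonneg (w p.1 - w p.2)]
    have h2 : 0 ≤ (η p.1 - η p.2) ^ 2 * J (p.1 - p.2) := mul_nonneg (sq_nonneg _) (hJ.nonneg _)
    have := mul_le_mul_of_nonneg_right h1 h2
    simp only [η] at this ⊢
    linarith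
  have b3 : ∫ x, g x * (w x * η x ^ 2) ≤ F * M * ∫ x, χ x ^ 2 := by
    rw [← integral_add_right_eq_self (fun x => χ x ^ 2) (-a), ← integral_const_mul]
    have i2 : Integrable fun x => F * M * η x ^ 2 :=
      ((hη.sq.continuous.integrable_of_hasCompactSupport hη.sq.compact)).const_mul _
    refine integral_mono ((IsTest.mul_left hw hη.sq).integrable_mul hg) i2 fun x => ?_
    have h1 : g x * w x ≤ F * M := by
      refine (le_abs_self _).trans ?_
      rw [abs_mul]
      exact mul_le_mul (hF x) (hM x) (abs_nonneg _) ((abs_nonneg _).trans (hF x))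
    have := mul_le_mul_of_nonneg_right h1 (sq_nonneg (η x))
    simp only [η] at this ⊢
    linarith
  have b4 : ∫ x in Metric.closedBall a 1, ‖∇ w x‖ ^ 2 ≤ ∫ x, ‖∇ (fun y => w y * η y) x‖ ^ 2 := by
    have : ∫ x in Metric.closedBall a 1, ‖∇ w x‖ ^ 2 =
        ∫ x in Metric.closedBall a 1, ‖∇ (fun y => w y * η y) x‖ ^ 2 := by
      refine setIntegral_congr_fun Metric.isClosed_closedBall.measurableSet fun x hx => ?_
      have he : (fun y => w y * η y) =ᶠ[𝓝 x] w := by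
        have : ∀ᶠ y in 𝓝 x, y ∈ Metric.ball a 2 :=
          Metric.isOpen_ball.mem_nhds (Metric.closedBall_subset_ball (by norm_num) hx)
        filter_upwards [this] with y hy
        have : η y = 1 := b.one_of_mem_closedBall (by
          rw [mem_closedBall_zero_iff, ← sub_eq_add_neg, ← dist_eq_norm]
          exact (Metric.mem_ball.1 hy).le)
        rw [this, mul_one]
      rw [he.gradient_eq]
    rw [this]
    exact setIntegral_le_integral hwη.integrable_norm_sq (Eventually.of_forall fun x => by positivity)
  have := mul_le_mul_of_nonneg_left b2 (by positivity : 0 ≤ c / 2)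
  linarith

/-- The difference quotient of `u` in direction `e` with step `h`. -/
noncomputable def diffQuot (u : Euc n → ℝ) (e : Euc n) (h : ℝ) (x : Euc n) : ℝ :=
  h⁻¹ * (u (x + h • e) - u x)

theorem contDiff_diffQuot {u : Euc n → ℝ} (hu : ContDiff ℝ 1 u) (e : Euc n) (h : ℝ) :
    ContDiff ℝ 1 (diffQuot u e h) :=
  contDiff_const.mul ((hu.comp (contDiff_id.add contDiff_const)).sub hu)

theorem exists_diffQuot_bound {u : Euc n → ℝ} (hM : ∃ M, ∀ x, |u x| ≤ M) (e : Euc n) (h : ℝ) :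
    ∃ M, ∀ x, |diffQuot u e h x| ≤ M := by
  obtain ⟨M, hM⟩ := hM
  refine ⟨|h⁻¹| * (M + M), fun x => ?_⟩
  rw [diffQuot, abs_mul]
  exact mul_le_mul_of_nonneg_left ((abs_sub _ _).trans (add_le_add (hM _) (hM _))) (abs_nonneg _)

/-- Mean value theorem for difference quotients. -/
theorem exists_diffQuot_eq {u : Euc n → ℝ} (hu : Differentiable ℝ u) (e : Euc n) {h : ℝ}
    (hh : 0 < h) (x : Euc n) :
    ∃ t ∈ Set.Icc (0 : ℝ) h, diffQuot u e h x = fderiv ℝ u (x + t • e) e := by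
  have hφ : ∀ t, HasDerivAt (fun t : ℝ => u (x + t • e)) (fderiv ℝ u (x + t • e) e) t := by
    intro t
    have h1 : HasDerivAt (fun t : ℝ => x + t • e) e t := by
      simpa using ((hasDerivAt_id t).smul_const e).const_add x
    exact (hu (x + t • e)).hasFDerivAt.comp_hasDerivAt t h1
  obtain ⟨t, ht, he⟩ := exists_hasDerivAt_eq_slope (fun t : ℝ => u (x + t • e)) _ hh
    (fun t _ => (hφ t).continuousAt.continuousWithinAt) fun t _ => hφ t
  refine ⟨t, Set.Ioo_subset_Icc_self ht, ?_⟩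
  rw [he, diffQuot]
  simp
  ring

/-- Nonnegativity of the variance of `φ` on the unit interval. -/
theorem sq_intervalIntegral_le {φ : ℝ → ℝ} (hφ : Continuous φ) :
    (∫ t in (0 : ℝ)..1, φ t) ^ 2 ≤ ∫ t in (0 : ℝ)..1, φ t ^ 2 := by
  set m := ∫ t in (0 : ℝ)..1, φ t with hm
  have h0 : 0 ≤ ∫ t in (0 : ℝ)..1, (φ t - m) ^ 2 :=
    intervalIntegral.integral_nonneg (by norm_num) fun t _ => sq_nonneg _
  have i1 : IntervalIntegrable (fun t => φ t ^ 2) volume 0 1 :=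
    (hφ.pow 2).intervalIntegrable _ _
  have i2 : IntervalIntegrable (fun t => 2 * m * φ t) volume 0 1 :=
    (continuous_const.mul hφ).intervalIntegrable _ _
  have e : ∫ t in (0 : ℝ)..1, (φ t - m) ^ 2 =
      (∫ t in (0 : ℝ)..1, φ t ^ 2) - 2 * m * m + m ^ 2 := by
    have : (fun t => (φ t - m) ^ 2) = fun t => φ t ^ 2 - 2 * m * φ t + m ^ 2 := by
      ext t; ring
    rw [this, intervalIntegral.integral_add (i1.sub i2) (by simp),
      intervalIntegral.integral_sub i1 i2, intervalIntegral.integral_const_mul, ← hm]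
    simp
  nlinarith

theorem setIntegral_closedBall_comp_add (F : Euc n → ℝ) (a v : Euc n) (r : ℝ) :
    ∫ x in Metric.closedBall a r, F (x + v) = ∫ x in Metric.closedBall (a + v) r, F x := by
  have := (measurePreserving_add_right (volume : Measure (Euc n)) v).setIntegral_preimage_emb
    (measurableEmbedding_addRight v) F (Metric.closedBall (a + v) r)
  rw [← this]
  congr 2
  ext x
  simp [Metric.mem_closedBall]

/-- The difference quotient is an average of `⟨∇u, e⟩` along a segment; Jensen and Fubini reduce its
square to unit balls with shifted centres. The bound is independent of `h`, which later allows the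
cutoff to be chosen before the step. -/
theorem setIntegral_diffQuot_sq_le {u : Euc n → ℝ} (hu : ContDiff ℝ 1 u) {K : ℝ}
    (hK : ∀ a, ∫ x in Metric.closedBall a 1, ‖∇ u x‖ ^ 2 ≤ K) (e : Euc n) {h : ℝ} (hh : 0 < h)
    (a : Euc n) :
    ∫ x in Metric.closedBall a 1, diffQuot u e h x ^ 2 ≤ ‖e‖ ^ 2 * K := by
  have hd := hu.differentiable one_ne_zero
  have hcg := continuous_gradient hu
  let G : Euc n → ℝ → ℝ := fun x t => ‖∇ u (x + t • h • e)‖ ^ 2 * ‖e‖ ^ 2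
  have hG : Continuous (Function.uncurry G) := by
    simp only [Function.uncurry_def, G]
    fun_prop
  have hpt : ∀ x, diffQuot u e h x ^ 2 ≤ ∫ t in (0 : ℝ)..1, G x t := by
    intro x
    have hφc : Continuous fun t : ℝ => inner ℝ (∇ u (x + t • h • e)) e := by fun_prop
    have hφ : ∀ t, HasDerivAt (fun t : ℝ => h⁻¹ * u (x + t • h • e))
        (inner ℝ (∇ u (x + t • h • e)) e) t := by
      intro t
      have h1 : HasDerivAt (fun t : ℝ => x + t • h • e) (h • e) t := by
        simpa using ((hasDerivAt_id t).smul_const (h • e)).const_add x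
      refine (((hd (x + t • h • e)).hasFDerivAt.comp_hasDerivAt t h1).const_mul h⁻¹).congr_deriv ?_
      rw [inner_gradient_left, map_smul, smul_eq_mul]
      field_simp
    have e1 : diffQuot u e h x = ∫ t in (0 : ℝ)..1, inner ℝ (∇ u (x + t • h • e)) e := by
      rw [intervalIntegral.integral_eq_sub_of_hasDerivAt (fun t _ => hφ t)
        (hφc.intervalIntegrable _ _), diffQuot]
      simp
      ring
    rw [e1]
    refine (sq_intervalIntegral_le hφc).trans ?_
    refine intervalIntegral.integral_mono_on (by norm_num)
      ((hφc.pow 2).intervalIntegrable _ _) ?_ fun t _ => ?_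
    · exact (hG.comp (by fun_prop : Continuous fun t : ℝ => (x, t))).intervalIntegrable _ _
    · simp only [G]
      rw [← mul_pow, ← sq_abs]
      gcongr
      exact abs_real_inner_le_norm _ _
  have hiG : Integrable (Function.uncurry G) ((volume.restrict (Metric.closedBall a 1)).prod
      (volume.restrict (Set.Ioc (0 : ℝ) 1))) := by
    rw [Measure.prod_restrict]
    exact (hG.continuousOn.integrableOn_compact
      ((isCompact_closedBall a 1).prod isCompact_Icc)).mono_set
      (Set.prod_mono subset_rfl Set.Ioc_subset_Icc_self)
  have hcw := (contDiff_diffQuot hu e h).continuous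
  calc ∫ x in Metric.closedBall a 1, diffQuot u e h x ^ 2
      ≤ ∫ x in Metric.closedBall a 1, ∫ t in Set.Ioc (0 : ℝ) 1, G x t := by
        refine integral_mono ((hcw.pow 2).continuousOn.integrableOn_compact
          (isCompact_closedBall a 1)) hiG.integral_prod_left fun x => ?_
        rw [← intervalIntegral.integral_of_le (by norm_num)]
        exact hpt x
    _ = ∫ t in Set.Ioc (0 : ℝ) 1, ∫ x in Metric.closedBall a 1, G x t :=
        integral_integral_swap hiG
    _ ≤ ∫ t in Set.Ioc (0 : ℝ) 1, ‖e‖ ^ 2 * K := by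
        refine integral_mono hiG.integral_prod_right (integrable_const _) fun t => ?_
        simp only [G]
        rw [integral_mul_const, mul_comm,
          setIntegral_closedBall_comp_add (fun x => ‖∇ u x‖ ^ 2)]
        exact mul_le_mul_of_nonneg_left (hK _) (by positivity)
    _ = ‖e‖ ^ 2 * K := by simp

end JumpDiffusion

/-! ### Slowly decaying cutoffs in the plane. -/

namespace JumpDiffusion

variable {n : ℕ}

theorem exists_lipschitz_smoothTransition :
    ∃ L, 0 ≤ L ∧ (∀ a b, |Real.smoothTransition a - Real.smoothTransition b| ≤ L * |a - b|) ∧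
      ∀ a, |deriv Real.smoothTransition a| ≤ L := by
  obtain ⟨L, hL⟩ := ((Real.smoothTransition.contDiff (n := 1)).contDiffOn
    (s := Set.Icc (0 : ℝ) 1)).exists_lipschitzOnWith one_ne_zero (convex_Icc _ _) isCompact_Icc
  have h : LipschitzWith L Real.smoothTransition := by
    refine LipschitzWith.of_dist_le_mul fun a b => ?_
    rw [← Real.smoothTransition.projIcc (x := a), ← Real.smoothTransition.projIcc (x := b)]
    refine (hL.dist_le_mul _ (Set.projIcc (0 : ℝ) 1 zero_le_one a).2 _
      (Set.projIcc (0 : ℝ) 1 zero_le_one b).2).trans ?_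
    have := (LipschitzWith.projIcc (zero_le_one (α := ℝ))).dist_le_mul a b
    gcongr
    simpa [Subtype.dist_eq] using this
  refine ⟨L, L.2, fun a b => ?_, fun a => ?_⟩
  · simpa [Real.dist_eq] using h.dist_le_mul a b
  · exact norm_deriv_le_of_lipschitz h

/-- Difference bound for negative powers with a small exponent. -/
theorem sq_rpow_sub_rpow_le {ε p q s : ℝ} (hε : 0 < ε) (hε' : ε ≤ 1 / 4) (hp : 1 ≤ p) (hq : 1 ≤ q)
    (hs : |p - q| ≤ s) :
    (p ^ (-ε) - q ^ (-ε)) ^ 2 ≤ 256 * ε ^ 2 * (s ^ 2 + s ^ 3) * p ^ (-(2 + 2 * ε)) := by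
  have hp0 : 0 < p := by linarith
  have hq0 : 0 < q := by linarith
  have hs0 : 0 ≤ s := (abs_nonneg _).trans hs
  obtain ⟨hs1, hs2⟩ := abs_le.1 hs
  have hW : 0 < p ^ (-(2 + 2 * ε)) := Real.rpow_pos_of_pos hp0 _
  -- For `s ≤ p / 2` one has `q ≥ p / 2`, and the mean value theorem gives the decay in `p`. For
  -- larger `s` the decay is paid for with powers of `s`, since `p < 2s`.
  rcases le_or_gt s (p / 2) with h | h
  · have hder : ∀ x ∈ Set.Ici (p / 2),
        HasDerivWithinAt (fun x : ℝ => x ^ (-ε)) (-ε * x ^ (-ε - 1)) (Set.Ici (p / 2)) x :=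
      fun x hx => (Real.hasDerivAt_rpow_const
        (Or.inl (by have : p / 2 ≤ x := hx; linarith))).hasDerivWithinAt
    have hbd : ∀ x ∈ Set.Ici (p / 2), ‖-ε * x ^ (-ε - 1)‖ ≤ ε * (4 * p ^ (-ε - 1)) := by
      intro x hx
      have hx' : p / 2 ≤ x := hx
      have hx0 : 0 < x := by linarith
      rw [norm_mul, norm_neg, Real.norm_of_nonneg hε.le, Real.norm_of_nonneg (by positivity)]
      gcongr
      calc x ^ (-ε - 1) ≤ (p / 2) ^ (-ε - 1) :=
            Real.rpow_le_rpow_of_nonpos (by positivity) hx' (by linarith)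
        _ = p ^ (-ε - 1) * (1 / 2 : ℝ) ^ (-ε - 1) := by
            rw [← Real.mul_rpow hp0.le (by norm_num)]; ring_nf
        _ ≤ p ^ (-ε - 1) * 4 := by
            gcongr
            rw [one_div, Real.inv_rpow (by norm_num), ← Real.rpow_neg (by norm_num)]
            calc (2 : ℝ) ^ (-(-ε - 1)) ≤ 2 ^ (2 : ℝ) :=
                  Real.rpow_le_rpow_of_exponent_le (by norm_num) (by linarith)
              _ = 4 := by norm_num
        _ = _ := by ring
    have := (convex_Ici (p / 2)).norm_image_sub_le_of_norm_hasDerivWithin_le hder hbd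
      (x := q) (y := p) (by rw [Set.mem_Ici]; linarith) (by rw [Set.mem_Ici]; linarith)
    rw [Real.norm_eq_abs, Real.norm_eq_abs] at this
    have h2 : |p ^ (-ε) - q ^ (-ε)| ≤ ε * (4 * p ^ (-ε - 1)) * s :=
      this.trans (by gcongr)
    have h3 : p ^ (-(2 + 2 * ε)) = (p ^ (-ε - 1)) ^ 2 := by
      rw [← Real.rpow_natCast, ← Real.rpow_mul hp0.le]; congr 1; push_cast; ring
    rw [← sq_abs, h3]
    calc |p ^ (-ε) - q ^ (-ε)| ^ 2 ≤ (ε * (4 * p ^ (-ε - 1)) * s) ^ 2 := by gcongr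
      _ = 16 * ε ^ 2 * s ^ 2 * (p ^ (-ε - 1)) ^ 2 := by ring
      _ ≤ 256 * ε ^ 2 * (s ^ 2 + s ^ 3) * (p ^ (-ε - 1)) ^ 2 := by
          gcongr
          · norm_num
          · linarith [pow_nonneg hs0 3]
  · have hs3 : 1 / 2 < s := by linarith
    have hs4 : 0 < s := by linarith
    have hlog : |Real.log p - Real.log q| ≤ Real.log (1 + s) := by
      rw [abs_le]
      constructor
      · have : Real.log q ≤ Real.log (p * (1 + s)) := Real.log_le_log hq0 (by nlinarith)
        rw [Real.log_mul (by positivity) (by positivity)] at this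
        linarith
      · have : Real.log p ≤ Real.log (q * (1 + s)) := Real.log_le_log hp0 (by nlinarith)
        rw [Real.log_mul (by positivity) (by positivity)] at this
        linarith
    have hexp : |p ^ (-ε) - q ^ (-ε)| ≤ ε * |Real.log p - Real.log q| := by
      have hder : ∀ x ∈ Set.Ici (0 : ℝ),
          HasDerivWithinAt (fun x : ℝ => Real.exp (x * (-ε))) (Real.exp (x * (-ε)) * (-ε))
            (Set.Ici 0) x := by
        intro x _
        have : HasDerivAt (fun x : ℝ => x * (-ε)) (-ε) x := by
          simpa using (hasDerivAt_id x).mul_const (-ε)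
        exact this.exp.hasDerivWithinAt
      have hbd : ∀ x ∈ Set.Ici (0 : ℝ), ‖Real.exp (x * (-ε)) * (-ε)‖ ≤ ε := by
        intro x hx
        rw [norm_mul, norm_neg, Real.norm_of_nonneg hε.le, Real.norm_of_nonneg (by positivity)]
        refine mul_le_of_le_one_left hε.le (Real.exp_le_one_iff.2 ?_)
        have : 0 ≤ x := hx
        nlinarith
      have := (convex_Ici (0 : ℝ)).norm_image_sub_le_of_norm_hasDerivWithin_le hder hbd
        (x := Real.log q) (y := Real.log p) (Real.log_nonneg hq) (Real.log_nonneg hp)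
      rw [Real.norm_eq_abs, Real.norm_eq_abs] at this
      rwa [Real.rpow_def_of_pos hp0, Real.rpow_def_of_pos hq0]
    -- The target power `s³` splits as `s^(1/2)`, which absorbs the logarithm, times `s^(5/2)`,
    -- which absorbs `p^(2+2ε)`; the latter uses `ε ≤ 1/4`. The constant is `256 = 32 · 8`.
    have hl2 : Real.log (1 + s) ^ 2 ≤ 32 * s ^ (1 / 2 : ℝ) := by
      have h1 : Real.log (1 + s) ≤ (1 + s) ^ (1 / 4 : ℝ) / (1 / 4) :=
        Real.log_le_rpow_div (by positivity) (by norm_num)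
      have h0 : 0 ≤ Real.log (1 + s) := Real.log_nonneg (by linarith)
      have h2 : ((1 + s) ^ (1 / 4 : ℝ)) ^ 2 ≤ 2 * s ^ (1 / 2 : ℝ) := by
        rw [← Real.rpow_natCast, ← Real.rpow_mul (by positivity)]
        calc (1 + s) ^ (1 / 4 * ((2 : ℕ) : ℝ)) ≤ (4 * s) ^ (1 / 4 * ((2 : ℕ) : ℝ)) := by
              gcongr; linarith
          _ = 4 ^ (1 / 2 : ℝ) * s ^ (1 / 2 : ℝ) := by
              rw [Real.mul_rpow (by norm_num) hs4.le]; norm_num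
          _ = _ := by
              congr 1
              rw [show (4 : ℝ) = 2 ^ (2 : ℝ) by norm_num, ← Real.rpow_mul (by norm_num)]; norm_num
      calc Real.log (1 + s) ^ 2 ≤ ((1 + s) ^ (1 / 4 : ℝ) / (1 / 4)) ^ 2 := by gcongr
        _ = 16 * ((1 + s) ^ (1 / 4 : ℝ)) ^ 2 := by ring
        _ ≤ _ := by linarith
    have hpw : 1 ≤ 8 * s ^ (5 / 2 : ℝ) * p ^ (-(2 + 2 * ε)) := by
      rw [Real.rpow_neg hp0.le, ← div_eq_mul_inv, one_le_div (by positivity)]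
      calc p ^ (2 + 2 * ε) ≤ p ^ (5 / 2 : ℝ) :=
            Real.rpow_le_rpow_of_exponent_le hp (by linarith)
        _ ≤ (2 * s) ^ (5 / 2 : ℝ) := by gcongr; linarith
        _ = 2 ^ (5 / 2 : ℝ) * s ^ (5 / 2 : ℝ) := Real.mul_rpow (by norm_num) hs4.le
        _ ≤ 8 * s ^ (5 / 2 : ℝ) := by
            gcongr
            calc (2 : ℝ) ^ (5 / 2 : ℝ) ≤ 2 ^ (3 : ℝ) :=
                  Real.rpow_le_rpow_of_exponent_le (by norm_num) (by norm_num)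
              _ = 8 := by norm_num
    have hs5 : s ^ (1 / 2 : ℝ) * s ^ (5 / 2 : ℝ) = s ^ 3 := by
      rw [← Real.rpow_add hs4, ← Real.rpow_natCast]; norm_num
    have hsp : 0 ≤ s ^ (1 / 2 : ℝ) := by positivity
    rw [← sq_abs]
    calc |p ^ (-ε) - q ^ (-ε)| ^ 2 ≤ (ε * Real.log (1 + s)) ^ 2 := by
          gcongr; exact hexp.trans (by gcongr)
      _ = ε ^ 2 * Real.log (1 + s) ^ 2 := by ring
      _ ≤ ε ^ 2 * (32 * s ^ (1 / 2 : ℝ)) := by gcongr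
      _ = ε ^ 2 * (32 * s ^ (1 / 2 : ℝ)) * 1 := by ring
      _ ≤ ε ^ 2 * (32 * s ^ (1 / 2 : ℝ)) * (8 * s ^ (5 / 2 : ℝ) * p ^ (-(2 + 2 * ε))) := by gcongr
      _ = 256 * ε ^ 2 * (s ^ (1 / 2 : ℝ) * s ^ (5 / 2 : ℝ)) * p ^ (-(2 + 2 * ε)) := by ring
      _ ≤ 256 * ε ^ 2 * (s ^ 2 + s ^ 3) * p ^ (-(2 + 2 * ε)) := by
          rw [hs5]; gcongr; linarith [sq_nonneg s]

/-- The weight `(1 + |x|²)^(-1-ε)`. -/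
noncomputable def weight (ε : ℝ) (x : Euc n) : ℝ := (1 + ‖x‖ ^ 2) ^ (-(1 + ε))

theorem weight_pos (ε : ℝ) (x : Euc n) : 0 < weight ε x := by
  unfold weight; positivity

theorem continuous_weight (ε : ℝ) : Continuous (weight ε : Euc n → ℝ) :=
  Continuous.rpow_const (by fun_prop) fun x => Or.inl (by positivity)

theorem weight_le_of_norm_sub_le {ε : ℝ} (hε : 0 < ε) (hε' : ε ≤ 1) {x y : Euc n}
    (h : ‖x - y‖ ≤ 1) : weight ε x ≤ 9 * weight ε y := by
  unfold weight
  have h1 : 1 + ‖y‖ ^ 2 ≤ 3 * (1 + ‖x‖ ^ 2) := by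
    have : ‖y‖ ≤ ‖x‖ + 1 := by
      have := norm_sub_norm_le y x
      rw [norm_sub_rev] at this; linarith
    nlinarith [norm_nonneg x, norm_nonneg y, sq_nonneg (‖x‖ - 1)]
  rw [Real.rpow_neg (by positivity), Real.rpow_neg (by positivity), ← div_eq_mul_inv,
    inv_le_iff_one_le_mul₀ (by positivity), div_mul_eq_mul_div, one_le_div (by positivity)]
  calc (1 + ‖y‖ ^ 2) ^ (1 + ε) ≤ (3 * (1 + ‖x‖ ^ 2)) ^ (1 + ε) := by gcongr
    _ = 3 ^ (1 + ε) * (1 + ‖x‖ ^ 2) ^ (1 + ε) := Real.mul_rpow (by norm_num) (by positivity)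
    _ ≤ 9 * (1 + ‖x‖ ^ 2) ^ (1 + ε) := by
        gcongr
        calc (3 : ℝ) ^ (1 + ε) ≤ 3 ^ (2 : ℝ) :=
              Real.rpow_le_rpow_of_exponent_le (by norm_num) (by linarith)
          _ = 9 := by norm_num

/-- In polar coordinates the integrand `r (1 + r²)^(-1-ε)` has an explicit primitive. The growth
like `1/ε` is beaten by the factor `ε²` in the cutoff's energy density. -/
theorem integral_weight {ε : ℝ} (hε : 0 < ε) :
    Integrable (weight ε : Euc 2 → ℝ) ∧
      ∫ x : Euc 2, weight ε x = volume.real (Metric.ball (0 : Euc 2) 1) / ε := by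
  let F : ℝ → ℝ := fun r => -(1 + r ^ 2) ^ (-ε) / (2 * ε)
  have hd : ∀ r, HasDerivAt F (r * (1 + r ^ 2) ^ (-(1 + ε))) r := by
    intro r
    have h1 : HasDerivAt (fun r : ℝ => 1 + r ^ 2) (2 * r) r := by
      simpa using (hasDerivAt_pow 2 r).const_add 1
    have h2 := ((h1.rpow_const (p := -ε) (Or.inl (by positivity))).neg.div_const (2 * ε))
    refine h2.congr_deriv ?_
    rw [show -ε - 1 = -(1 + ε) by ring]
    field_simp
  have hnn : ∀ r ∈ Set.Ioi (0 : ℝ), 0 ≤ r * (1 + r ^ 2) ^ (-(1 + ε)) := fun r hr => by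
    have : 0 < r := hr
    positivity
  have hlim : Tendsto F atTop (𝓝 0) := by
    have h1 : Tendsto (fun r : ℝ => 1 + r ^ 2) atTop atTop :=
      tendsto_atTop_add_const_left _ _ (tendsto_pow_atTop two_ne_zero)
    have h2 := (((tendsto_rpow_neg_atTop hε).comp h1).neg).div_const (2 * ε)
    simpa [F, Function.comp_def] using h2
  have hint := integrableOn_Ioi_deriv_of_nonneg' (fun r _ => hd r) hnn hlim
  have hval := integral_Ioi_of_hasDerivAt_of_tendsto' (fun r _ => hd r) hint hlim
  have hF0 : F 0 = -(1 / (2 * ε)) := by simp [F]; ring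
  constructor
  · have := (integrable_fun_norm_addHaar (volume : Measure (Euc 2))
      (f := fun r => (1 + r ^ 2) ^ (-(1 + ε)))).2 (by simpa using hint)
    exact this
  · have := integral_fun_norm_addHaar (volume : Measure (Euc 2))
      (fun r => (1 + r ^ 2) ^ (-(1 + ε)))
    unfold weight
    rw [this]
    simp only [finrank_euclideanSpace, Fintype.card_fin, Nat.add_one_sub_one, pow_one, smul_eq_mul,
      nsmul_eq_mul]
    rw [hval, hF0]
    field_simp
    push_cast
    ring

/-- A uniformly locally square integrable function is square integrable against the weight. -/
theorem integral_sq_mul_weight_le {ε : ℝ} (hε : 0 < ε) (hε' : ε ≤ 1)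
    (hi : Integrable (weight ε : Euc n → ℝ)) {w : Euc n → ℝ} (hw : Continuous w) {K : ℝ}
    (hK0 : 0 ≤ K) (hK : ∀ a, ∫ x in Metric.closedBall a 1, w x ^ 2 ≤ K) :
    Integrable (fun x => w x ^ 2 * weight ε x) ∧
      (∫ x, w x ^ 2 * weight ε x) * volume.real (Metric.closedBall (0 : Euc n) 1) ≤
        9 * K * ∫ x : Euc n, weight ε x := by
  have hWc := continuous_weight (n := n) ε
  have hball : ∀ a : Euc n, volume (Metric.closedBall a 1) =
      volume (Metric.closedBall (0 : Euc n) 1) := fun a => by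
    rw [Measure.addHaar_closedBall_center]
  have key : (∫⁻ x, ENNReal.ofReal (w x ^ 2 * weight ε x)) *
      volume (Metric.closedBall (0 : Euc n) 1) ≤
        ENNReal.ofReal (9 * K * ∫ x : Euc n, weight ε x) := by
    have hset : MeasurableSet {p : Euc n × Euc n | dist p.2 p.1 ≤ 1} :=
      (isClosed_le (by fun_prop) continuous_const).measurableSet
    let G : Euc n × Euc n → ENNReal := {p : Euc n × Euc n | dist p.2 p.1 ≤ 1}.indicator
      fun p => ENNReal.ofReal (9 * weight ε p.2) * ENNReal.ofReal (w p.1 ^ 2)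
    have hG : Measurable G := by
      refine Measurable.indicator ?_ hset
      fun_prop
    -- Tonelli on the pairs at distance at most `1`: there the weight at `x` is at most `9` times
    -- that at `y`, and after swapping, the inner integral of `w²` runs over a unit ball around `y`.
    calc (∫⁻ x, ENNReal.ofReal (w x ^ 2 * weight ε x)) * volume (Metric.closedBall (0 : Euc n) 1)
        = ∫⁻ x, ∫⁻ y in Metric.closedBall x 1, ENNReal.ofReal (w x ^ 2 * weight ε x) := by
          rw [← lintegral_mul_const _ (by fun_prop)]
          simp_rw [setLIntegral_const, hball]
      _ ≤ ∫⁻ x, ∫⁻ y, G (x, y) := by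
          refine lintegral_mono fun x => ?_
          rw [← lintegral_indicator Metric.isClosed_closedBall.measurableSet]
          refine lintegral_mono fun y => ?_
          simp only [G, Set.indicator, Metric.mem_closedBall, Set.mem_ofPred_eq]
          split_ifs with h
          · rw [← ENNReal.ofReal_mul (by have := weight_pos ε y; positivity)]
            refine ENNReal.ofReal_le_ofReal ?_
            have := weight_le_of_norm_sub_le hε hε' (x := x) (y := y)
              (by rwa [← dist_eq_norm, dist_comm])
            nlinarith [sq_nonneg (w x)]
          · exact le_rfl
      _ = ∫⁻ y, ∫⁻ x, G (x, y) := lintegral_lintegral_swap hG.aemeasurable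
      _ ≤ ∫⁻ y : Euc n, ENNReal.ofReal (9 * weight ε y) * ENNReal.ofReal K := by
          refine lintegral_mono fun y => ?_
          have : ∀ x, G (x, y) = ENNReal.ofReal (9 * weight ε y) *
              (Metric.closedBall y 1).indicator (fun x => ENNReal.ofReal (w x ^ 2)) x := by
            intro x
            simp only [G, Set.indicator, Metric.mem_closedBall, Set.mem_ofPred_eq, dist_comm y x]
            split_ifs <;> simp
          simp_rw [this]
          rw [lintegral_const_mul _ (Measurable.indicator (by fun_prop)
            Metric.isClosed_closedBall.measurableSet),
            lintegral_indicator Metric.isClosed_closedBall.measurableSet]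
          gcongr
          rw [← ofReal_integral_eq_lintegral_ofReal]
          · exact ENNReal.ofReal_le_ofReal (hK y)
          · exact (hw.pow 2).continuousOn.integrableOn_compact (isCompact_closedBall y 1)
          · exact Eventually.of_forall fun x => sq_nonneg _
      _ = ENNReal.ofReal (9 * K * ∫ x : Euc n, weight ε x) := by
          rw [lintegral_mul_const _ (by fun_prop), ← ofReal_integral_eq_lintegral_ofReal
            (hi.const_mul 9) (Eventually.of_forall fun x => by
              have := weight_pos ε x; simp only [Pi.zero_apply]; positivity),
            integral_const_mul, ← ENNReal.ofReal_mul]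
          · ring_nf
          · have : 0 ≤ ∫ x : Euc n, weight ε x := integral_nonneg fun x => (weight_pos ε x).le
            positivity
  have hvpos : volume (Metric.closedBall (0 : Euc n) 1) ≠ 0 :=
    (Metric.measure_closedBall_pos _ _ one_pos).ne'
  have hvtop : volume (Metric.closedBall (0 : Euc n) 1) ≠ ⊤ := measure_closedBall_lt_top.ne
  have hnn : ∀ x, 0 ≤ w x ^ 2 * weight ε x := fun x =>
    mul_nonneg (sq_nonneg _) (weight_pos ε x).le
  have hfin : ∫⁻ x, ENNReal.ofReal (w x ^ 2 * weight ε x) ≠ ⊤ := by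
    intro h
    rw [h, ENNReal.top_mul hvpos] at key
    exact ENNReal.ofReal_ne_top (top_le_iff.1 key)
  have hint : Integrable (fun x => w x ^ 2 * weight ε x) := by
    refine ⟨(by fun_prop : Continuous _).aestronglyMeasurable, ?_⟩
    rw [hasFiniteIntegral_iff_ofReal (Eventually.of_forall hnn)]
    exact hfin.lt_top
  refine ⟨hint, ?_⟩
  rw [integral_eq_lintegral_of_nonneg_ae (Eventually.of_forall hnn) hint.1, Measure.real,
    ← ENNReal.toReal_mul]
  refine ENNReal.toReal_le_of_le_ofReal ?_ key
  have : 0 ≤ ∫ x : Euc n, weight ε x := integral_nonneg fun x => (weight_pos ε x).le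
  positivity

end JumpDiffusion

/-! ### Construction and energy of the spatial cutoff. -/

namespace JumpDiffusion

variable {n : ℕ} {J : Euc n → ℝ}

theorem abs_sqrt_sub_sqrt_le (x y : Euc n) :
    |√(1 + ‖x‖ ^ 2) - √(1 + ‖y‖ ^ 2)| ≤ ‖x - y‖ := by
  set p := √(1 + ‖x‖ ^ 2) with hp
  set q := √(1 + ‖y‖ ^ 2) with hq
  have hp2 : p ^ 2 = 1 + ‖x‖ ^ 2 := Real.sq_sqrt (by positivity)
  have hq2 : q ^ 2 = 1 + ‖y‖ ^ 2 := Real.sq_sqrt (by positivity)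
  have hpx : ‖x‖ ≤ p := Real.le_sqrt_of_sq_le (by linarith)
  have hqy : ‖y‖ ≤ q := Real.le_sqrt_of_sq_le (by linarith)
  have hp1 : 0 < p := Real.sqrt_pos.2 (by positivity)
  have hq1 : 0 < q := Real.sqrt_pos.2 (by positivity)
  refine le_of_mul_le_mul_right ?_ (add_pos hp1 hq1)
  calc |p - q| * (p + q) = |p ^ 2 - q ^ 2| := by
        rw [← abs_of_pos (add_pos hp1 hq1), ← abs_mul]; ring_nf
    _ = |‖x‖ - ‖y‖| * (‖x‖ + ‖y‖) := by
        rw [hp2, hq2, show 1 + ‖x‖ ^ 2 - (1 + ‖y‖ ^ 2) = (‖x‖ - ‖y‖) * (‖x‖ + ‖y‖) by ring,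
          abs_mul, abs_of_nonneg (by positivity : 0 ≤ ‖x‖ + ‖y‖)]
    _ ≤ ‖x - y‖ * (p + q) := by
        gcongr
        exact abs_norm_sub_norm_le x y

/-- A cutoff function with slow, logarithmic-type decay. -/
noncomputable def slowCutoff (ε : ℝ) (x : Euc n) : ℝ :=
  Real.smoothTransition (3 * (1 + ‖x‖ ^ 2) ^ (-(ε / 2)) - 1)

theorem slowCutoff_base (ε : ℝ) (x : Euc n) :
    (1 + ‖x‖ ^ 2) ^ (-(ε / 2)) = √(1 + ‖x‖ ^ 2) ^ (-ε) := by
  rw [Real.sqrt_eq_rpow, ← Real.rpow_mul (by positivity)]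
  congr 1
  ring

theorem one_le_sqrt_one_add (x : Euc n) : 1 ≤ √(1 + ‖x‖ ^ 2) :=
  Real.one_le_sqrt.2 (by linarith [sq_nonneg ‖x‖])

theorem slowCutoff_mem (ε : ℝ) (x : Euc n) : 0 ≤ slowCutoff ε x ∧ slowCutoff ε x ≤ 1 :=
  ⟨Real.smoothTransition.nonneg _, Real.smoothTransition.le_one _⟩

theorem isTest_slowCutoff {ε : ℝ} (hε : 0 < ε) : IsTest (slowCutoff ε : Euc n → ℝ) := by
  constructor
  · refine Real.smoothTransition.contDiff.comp (ContDiff.sub (contDiff_const.mul ?_) contDiff_const)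
    exact ContDiff.rpow_const_of_ne (contDiff_const.add (contDiff_norm_sq ℝ))
      fun x => (by positivity : (0 : ℝ) < 1 + ‖x‖ ^ 2).ne'
  -- At radius `3^(1/ε)` and beyond, the power `(1 + ‖x‖²)^(-ε/2)` is at most `1/3`, so the argument
  -- of the transition is nonpositive.
  · refine HasCompactSupport.intro (isCompact_closedBall (0 : Euc n) (3 ^ ε⁻¹)) fun x hx => ?_
    refine Real.smoothTransition.zero_of_nonpos ?_
    rw [mem_closedBall_zero_iff, not_le] at hx
    have h1 := one_le_sqrt_one_add x
    have h2 : ‖x‖ ≤ √(1 + ‖x‖ ^ 2) := Real.le_sqrt_of_sq_le (by linarith)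
    have h3 : 3 ≤ √(1 + ‖x‖ ^ 2) ^ ε := by
      calc (3 : ℝ) = (3 ^ ε⁻¹) ^ ε := by
            rw [← Real.rpow_mul (by norm_num), inv_mul_cancel₀ hε.ne', Real.rpow_one]
        _ ≤ _ := Real.rpow_le_rpow (by positivity) (hx.le.trans h2) hε.le
    rw [slowCutoff_base, Real.rpow_neg (by positivity), ← div_eq_mul_inv, sub_nonpos,
      div_le_one (by positivity)]
    exact h3

theorem slowCutoff_eq_one {ε R : ℝ} (hε : 0 < ε) (hR : 2 / 3 ≤ √(1 + R ^ 2) ^ (-ε)) {x : Euc n}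
    (hx : ‖x‖ ≤ R) : slowCutoff ε x = 1 := by
  refine Real.smoothTransition.one_of_one_le ?_
  rw [slowCutoff_base]
  have : √(1 + R ^ 2) ^ (-ε) ≤ √(1 + ‖x‖ ^ 2) ^ (-ε) := by
    refine Real.rpow_le_rpow_of_nonpos (by linarith [one_le_sqrt_one_add x]) ?_ (by linarith)
    gcongr
  linarith

/-- The cutoff is a Lipschitz function of `√(1 + ‖x‖²)^(-ε)`, so `sq_rpow_sub_rpow_le` applies. Its
cubic term is where the third moment of `J` becomes necessary. -/
theorem exists_slowCutoff_bound :
    ∃ C, 0 ≤ C ∧ ∀ ε, 0 < ε → ε ≤ 1 / 4 →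
      (∀ x y : Euc n, (slowCutoff ε x - slowCutoff ε y) ^ 2 ≤
        C * ε ^ 2 * (‖x - y‖ ^ 2 + ‖x - y‖ ^ 3) * weight ε y) ∧
      ∀ x : Euc n, ‖∇ (slowCutoff ε) x‖ ^ 2 ≤ C * ε ^ 2 * weight ε x := by
  obtain ⟨L, hL0, hL, -⟩ := exists_lipschitz_smoothTransition
  have main : ∀ ε, 0 < ε → ε ≤ 1 / 4 → ∀ x y : Euc n,
      (slowCutoff ε x - slowCutoff ε y) ^ 2 ≤
        (L ^ 2 * 9 * 256) * ε ^ 2 * (‖x - y‖ ^ 2 + ‖x - y‖ ^ 3) * weight ε y := by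
    intro ε hε hε' x y
    have h1 := sq_rpow_sub_rpow_le hε hε' (one_le_sqrt_one_add y) (one_le_sqrt_one_add x)
      ((abs_sqrt_sub_sqrt_le y x).trans_eq (norm_sub_rev y x))
    have hw : √(1 + ‖y‖ ^ 2) ^ (-(2 + 2 * ε)) = weight ε y := by
      rw [weight, Real.sqrt_eq_rpow, ← Real.rpow_mul (by positivity)]
      congr 1
      ring
    rw [hw, ← slowCutoff_base, ← slowCutoff_base] at h1
    have h2 := hL (3 * (1 + ‖x‖ ^ 2) ^ (-(ε / 2)) - 1) (3 * (1 + ‖y‖ ^ 2) ^ (-(ε / 2)) - 1)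
    have h3 : (slowCutoff ε x - slowCutoff ε y) ^ 2 ≤
        L ^ 2 * (3 * (1 + ‖x‖ ^ 2) ^ (-(ε / 2)) - 1 - (3 * (1 + ‖y‖ ^ 2) ^ (-(ε / 2)) - 1)) ^ 2 := by
      rw [← sq_abs, ← sq_abs (_ - _ - _), ← mul_pow]
      exact pow_le_pow_left₀ (abs_nonneg _) h2 2
    calc _ ≤ _ := h3
      _ = L ^ 2 * 9 * ((1 + ‖y‖ ^ 2) ^ (-(ε / 2)) - (1 + ‖x‖ ^ 2) ^ (-(ε / 2))) ^ 2 := by ring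
      _ ≤ L ^ 2 * 9 * (256 * ε ^ 2 * (‖x - y‖ ^ 2 + ‖x - y‖ ^ 3) * weight ε y) := by gcongr
      _ = _ := by ring
  refine ⟨2 * (L ^ 2 * 9 * 256), by positivity, fun ε hε hε' => ⟨fun x y => ?_, fun x => ?_⟩⟩
  · refine (main ε hε hε' x y).trans ?_
    have := weight_pos ε y
    have h0 : 0 ≤ (L ^ 2 * 9 * 256) * ε ^ 2 * (‖x - y‖ ^ 2 + ‖x - y‖ ^ 3) * weight ε y := by
      positivity
    linarith
  · rw [norm_gradient]
    have hW := weight_pos ε x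
    set B := 2 * (L ^ 2 * 9 * 256) * ε ^ 2 * weight ε x with hB
    have hB0 : 0 ≤ B := by positivity
    -- The gradient bound is read off the difference bound near `x`. The factor `2` comes from the
    -- cubic term being at most the quadratic one within distance `1`.
    have h : ‖fderiv ℝ (slowCutoff ε) x‖ ≤ √B := by
      refine norm_fderiv_le_of_lip' ℝ (Real.sqrt_nonneg _) ?_
      filter_upwards [Metric.closedBall_mem_nhds x one_pos] with y hy
      rw [Metric.mem_closedBall, dist_eq_norm] at hy
      have h1 := main ε hε hε' y x
      have h2 : ‖y - x‖ ^ 3 ≤ ‖y - x‖ ^ 2 :=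
        pow_le_pow_of_le_one (norm_nonneg _) hy (by norm_num)
      rw [Real.norm_eq_abs]
      refine abs_le_of_sq_le_sq ?_ (by positivity)
      rw [mul_pow, Real.sq_sqrt hB0]
      refine h1.trans ?_
      rw [hB]
      have h3 : ‖y - x‖ ^ 2 + ‖y - x‖ ^ 3 ≤ 2 * ‖y - x‖ ^ 2 := by linarith
      calc _ ≤ (L ^ 2 * 9 * 256) * ε ^ 2 * (2 * ‖y - x‖ ^ 2) * weight ε x := by gcongr
        _ = _ := by ring
    calc _ ≤ √B ^ 2 := by gcongr
      _ = B := Real.sq_sqrt hB0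

/-- In the plane there are cutoff functions, equal to one on a prescribed ball, with arbitrarily
small energy with respect to any uniformly locally square integrable density. -/
theorem exists_cutoff {J : Euc 2 → ℝ} (hJ : IsJumpKernel J)
    (hk : Integrable fun z : Euc 2 => ‖z‖ ^ 2 * J z)
    (hk' : Integrable fun z : Euc 2 => ‖z‖ ^ 3 * J z) {K : ℝ} (hK : 0 ≤ K) (R : ℝ) {s : ℝ}
    (hs : 0 < s) :
    ∃ η : Euc 2 → ℝ, IsTest η ∧ (∀ x, 0 ≤ η x ∧ η x ≤ 1) ∧ (∀ x, ‖x‖ ≤ R → η x = 1) ∧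
      ∀ w : Euc 2 → ℝ, Continuous w → (∀ a, ∫ x in Metric.closedBall a 1, w x ^ 2 ≤ K) →
        ∫ x, w x ^ 2 * ‖∇ η x‖ ^ 2 ≤ s ∧
        Integrable (fun p : Euc 2 × Euc 2 =>
          w p.2 ^ 2 * (η p.1 - η p.2) ^ 2 * J (p.1 - p.2)) ∧
        ∫ p : Euc 2 × Euc 2, w p.2 ^ 2 * (η p.1 - η p.2) ^ 2 * J (p.1 - p.2) ≤ s := by
  obtain ⟨C, hC0, hC⟩ := exists_slowCutoff_bound (n := 2)
  have hkk : Integrable fun z : Euc 2 => (‖z‖ ^ 2 + ‖z‖ ^ 3) * J z := by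
    simp only [add_mul]
    exact hk.add hk'
  set m := ∫ z : Euc 2, (‖z‖ ^ 2 + ‖z‖ ^ 3) * J z with hm
  have hm0 : 0 ≤ m := integral_nonneg fun z => mul_nonneg (by positivity) (hJ.nonneg _)
  set V := volume.real (Metric.closedBall (0 : Euc 2) 1) with hV
  have hV0 : 0 < V := ENNReal.toReal_pos (Metric.measure_closedBall_pos _ _ one_pos).ne'
    measure_closedBall_lt_top.ne
  have hVb : volume.real (Metric.ball (0 : Euc 2) 1) = V := by
    rw [hV, Measure.real, Measure.real, Measure.addHaar_closedBall_eq_addHaar_ball]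
  have ev1 : ∀ᶠ ε in 𝓝[>] (0 : ℝ), 2 / 3 < √(1 + R ^ 2) ^ (-ε) := by
    have hp : 0 < √(1 + R ^ 2) := Real.sqrt_pos.2 (by positivity)
    have : ContinuousAt (fun ε : ℝ => √(1 + R ^ 2) ^ (-ε)) 0 :=
      continuousAt_const.rpow continuousAt_neg (Or.inl hp.ne')
    exact nhdsWithin_le_nhds (this.eventually (lt_mem_nhds (by simp; norm_num)))
  have ev2 : ∀ᶠ ε in 𝓝[>] (0 : ℝ), ε < 1 / 4 :=
    nhdsWithin_le_nhds (eventually_lt_nhds (by norm_num))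
  have ev3 : ∀ᶠ ε in 𝓝[>] (0 : ℝ), C * (9 * K) * (1 + m) * ε < s := by
    have : ContinuousAt (fun ε : ℝ => C * (9 * K) * (1 + m) * ε) 0 := by fun_prop
    exact nhdsWithin_le_nhds (this.eventually (gt_mem_nhds (by simpa using hs)))
  have ev4 : ∀ᶠ ε in 𝓝[>] (0 : ℝ), 0 < ε := eventually_mem_nhdsWithin
  -- Both energies are of size `ε² · (9K / ε)` times constants, hence `O(ε)`. Only `K` enters, so
  -- one `ε` works for every admissible `w`.
  obtain ⟨ε, ⟨⟨h1, h2⟩, h3⟩, hε⟩ := (((ev1.and ev2).and ev3).and ev4).exists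
  obtain ⟨hC1, hC2⟩ := hC ε hε h2.le
  have hη : IsTest (slowCutoff ε : Euc 2 → ℝ) := isTest_slowCutoff hε
  refine ⟨slowCutoff ε, hη, slowCutoff_mem ε, fun x hx => slowCutoff_eq_one hε h1.le hx,
    fun w hw hwK => ?_⟩
  obtain ⟨hWi, hW⟩ := integral_weight hε
  obtain ⟨hi, hle⟩ := integral_sq_mul_weight_le hε (by linarith) hWi hw hK hwK
  have hI : ∫ x, w x ^ 2 * weight ε x ≤ 9 * K / ε := by
    rw [hW, hVb] at hle
    refine le_of_mul_le_mul_right (hle.trans_eq ?_) hV0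
    ring
  have hI0 : 0 ≤ ∫ x, w x ^ 2 * weight ε x :=
    integral_nonneg fun x => mul_nonneg (sq_nonneg _) (weight_pos ε x).le
  have hCI : C * ε ^ 2 * (∫ x, w x ^ 2 * weight ε x) ≤ C * (9 * K) * ε := by
    calc _ ≤ C * ε ^ 2 * (9 * K / ε) := by gcongr
      _ = _ := by field_simp
  have hdom := (integrable_mul_kernel hi hkk).const_mul (C * ε ^ 2)
  have hpt : ∀ p : Euc 2 × Euc 2, w p.2 ^ 2 * (slowCutoff ε p.1 - slowCutoff ε p.2) ^ 2 *
      J (p.1 - p.2) ≤ C * ε ^ 2 * ((w p.2 ^ 2 * weight ε p.2) *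
        ((‖p.1 - p.2‖ ^ 2 + ‖p.1 - p.2‖ ^ 3) * J (p.1 - p.2))) := by
    intro p
    have := mul_le_mul_of_nonneg_right (mul_le_mul_of_nonneg_left (hC1 p.1 p.2)
      (sq_nonneg (w p.2))) (hJ.nonneg (p.1 - p.2))
    linarith
  have hint : Integrable (fun p : Euc 2 × Euc 2 =>
      w p.2 ^ 2 * (slowCutoff ε p.1 - slowCutoff ε p.2) ^ 2 * J (p.1 - p.2)) := by
    refine hdom.mono' (Measurable.aestronglyMeasurable ?_) (Eventually.of_forall fun p => ?_)
    · have hc := hη.continuous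
      exact (by fun_prop : Continuous fun p : Euc 2 × Euc 2 =>
        w p.2 ^ 2 * (slowCutoff ε p.1 - slowCutoff ε p.2) ^ 2).measurable.mul hJ.measurable_sub
    · rw [Real.norm_of_nonneg (mul_nonneg (by positivity) (hJ.nonneg _))]
      exact hpt p
  refine ⟨?_, hint, ?_⟩
  · have hw2 : Continuous fun x => w x ^ 2 := hw.pow 2
    calc ∫ x, w x ^ 2 * ‖∇ (slowCutoff ε) x‖ ^ 2
        ≤ ∫ x, C * ε ^ 2 * (w x ^ 2 * weight ε x) := by
          refine integral_mono (hη.integrable_mul_norm_sq hw2) (hi.const_mul _) fun x => ?_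
          have := mul_le_mul_of_nonneg_left (hC2 x) (sq_nonneg (w x))
          simp only
          linarith
      _ ≤ C * (9 * K) * ε := by rw [integral_const_mul]; exact hCI
      _ ≤ s := by
          refine le_trans ?_ h3.le
          have : 0 ≤ C * (9 * K) * m * ε := by positivity
          linarith
  · calc ∫ p : Euc 2 × Euc 2, w p.2 ^ 2 * (slowCutoff ε p.1 - slowCutoff ε p.2) ^ 2 *
          J (p.1 - p.2)
        ≤ ∫ p : Euc 2 × Euc 2, C * ε ^ 2 * ((w p.2 ^ 2 * weight ε p.2) *
            ((‖p.1 - p.2‖ ^ 2 + ‖p.1 - p.2‖ ^ 3) * J (p.1 - p.2))) :=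
          integral_mono hint hdom hpt
      _ = C * ε ^ 2 * (∫ x, w x ^ 2 * weight ε x) * m := by
          rw [integral_const_mul, integral_mul_kernel hi hkk]; ring
      _ ≤ C * (9 * K) * ε * m := by gcongr
      _ ≤ s := by
          refine le_trans ?_ h3.le
          have : 0 ≤ C * (9 * K) * ε := by positivity
          linarith

/-! ### Cutoff in the values. -/

theorem mul_sq_log_sub_log_le {a b : ℝ} (ha : 0 < a) (hb : 0 < b) :
    a * b * (Real.log a - Real.log b) ^ 2 ≤ (a - b) ^ 2 := by
  wlog hab : b ≤ a generalizing a b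
  · have := this hb ha (le_of_not_ge hab)
    linarith
  -- With `a = e^(y+x)` and `b = e^(y-x)` the inequality is `x ≤ sinh x`; in other words, the
  -- geometric mean is below the logarithmic mean.
  set x := (Real.log a - Real.log b) / 2 with hx
  set y := (Real.log a + Real.log b) / 2 with hy
  have hx0 : 0 ≤ x := by linarith [Real.log_le_log hb hab]
  have ea : a = Real.exp y * Real.exp x := by
    rw [← Real.exp_add, show y + x = Real.log a by rw [hx, hy]; ring, Real.exp_log ha]
  have eb : b = Real.exp y * Real.exp (-x) := by
    rw [← Real.exp_add, show y + -x = Real.log b by rw [hx, hy]; ring, Real.exp_log hb]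
  have h1 : a - b = 2 * Real.exp y * Real.sinh x := by
    rw [Real.sinh_eq, ea, eb]; ring
  have h2 : a * b = Real.exp y ^ 2 := by
    rw [ea, eb]
    have : Real.exp x * Real.exp (-x) = 1 := by rw [← Real.exp_add]; simp
    linear_combination Real.exp y ^ 2 * this
  have h3 : x ≤ Real.sinh x := Real.self_le_sinh_iff.2 hx0
  rw [h1, h2, show Real.log a - Real.log b = 2 * x by rw [hx]; ring, mul_pow, mul_pow, mul_pow]
  have := pow_le_pow_left₀ hx0 h3 2
  nlinarith [sq_nonneg (Real.exp y)]

/-- Cutoff in the values: `r` vanishes near the negative axis, equals one beyond `m`, and has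
arbitrarily small logarithmic slope. -/
theorem exists_value_cutoff {κ m : ℝ} (hκ : 0 < κ) (hm : 0 < m) :
    ∃ r : ℝ → ℝ, ContDiff ℝ 1 r ∧ (∀ s, 0 ≤ r s ∧ r s ≤ 1) ∧ (∀ s, s ≤ 0 → r s = 0) ∧
      (∀ s, m ≤ s → r s = 1) ∧ (∀ s, (s * deriv r s) ^ 2 ≤ κ) ∧
      ∀ a b, 0 < a → 0 < b → a * b * (r a - r b) ^ 2 ≤ κ * (a - b) ^ 2 := by
  obtain ⟨L, hL0, hL, hL'⟩ := exists_lipschitz_smoothTransition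
  obtain ⟨t, ht, htκ⟩ : ∃ t, 0 < t ∧ (L * t) ^ 2 ≤ κ := by
    refine ⟨√κ / (L + 1), by positivity, ?_⟩
    have : L * (√κ / (L + 1)) ≤ √κ := by
      rw [mul_div_assoc', div_le_iff₀ (by positivity)]
      nlinarith [Real.sqrt_nonneg κ]
    calc _ ≤ √κ ^ 2 := by gcongr
      _ = κ := Real.sq_sqrt hκ.le
  let φ : ℝ → ℝ := fun s => Real.smoothTransition (1 + t * (Real.log s - Real.log m))
  let r : ℝ → ℝ := fun s => if s ≤ 0 then 0 else φ s
  -- `d` is the point where `1 + t log(s / m)` vanishes. Below it `r` is identically zero, so gluing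
  -- at `s = 0` costs no smoothness.
  set d := m * Real.exp (-(1 / t)) with hd
  have hd0 : 0 < d := by positivity
  have hzero : ∀ s, s < d → r s = 0 := by
    intro s hs
    simp only [r]
    split_ifs with h
    · rfl
    · refine Real.smoothTransition.zero_of_nonpos ?_
      have : Real.log s ≤ Real.log d := Real.log_le_log (not_le.1 h) hs.le
      rw [hd, Real.log_mul hm.ne' (Real.exp_pos _).ne', Real.log_exp] at this
      have h1 : t * (Real.log s - Real.log m) ≤ t * (-(1 / t)) := by gcongr; linarith
      have h2 : t * (-(1 / t)) = -1 := by field_simp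
      linarith
  have hpos : ∀ s, 0 < s → r s = φ s := fun s hs => by simp [r, not_le.2 hs]
  have hev : ∀ s, 0 < s → r =ᶠ[𝓝 s] φ := fun s hs => by
    filter_upwards [lt_mem_nhds hs] with x hx using hpos x hx
  have hev0 : ∀ s, s < d → r =ᶠ[𝓝 s] fun _ => 0 := fun s hs => by
    filter_upwards [gt_mem_nhds hs] with x hx using hzero x hx
  have hφd : ∀ s, 0 < s → HasDerivAt φ
      (deriv Real.smoothTransition (1 + t * (Real.log s - Real.log m)) * (t * s⁻¹)) s := by
    intro s hs
    have h1 : HasDerivAt (fun s => 1 + t * (Real.log s - Real.log m)) (t * s⁻¹) s :=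
      (((Real.hasDerivAt_log hs.ne').sub_const _).const_mul t).const_add 1
    have h2 : HasDerivAt Real.smoothTransition _ (1 + t * (Real.log s - Real.log m)) :=
      ((Real.smoothTransition.contDiff (n := 1)).differentiable (by norm_num) _).hasDerivAt
    exact h2.comp s h1
  refine ⟨r, ?_, ?_, fun s hs => by simp [r, hs], ?_, ?_, ?_⟩
  · rw [contDiff_iff_contDiffAt]
    intro s
    rcases lt_or_ge s d with h | h
    · exact contDiffAt_const.congr_of_eventuallyEq (hev0 s h)
    · have hs : 0 < s := hd0.trans_le h
      refine ContDiffAt.congr_of_eventuallyEq ?_ (hev s hs)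
      refine Real.smoothTransition.contDiff.contDiffAt.comp s ?_
      exact contDiffAt_const.add (contDiffAt_const.mul
        ((Real.contDiffAt_log.2 hs.ne').sub contDiffAt_const))
  · intro s
    simp only [r]
    split_ifs
    · simp
    · exact ⟨Real.smoothTransition.nonneg _, Real.smoothTransition.le_one _⟩
  · intro s hs
    rw [hpos s (hm.trans_le hs)]
    refine Real.smoothTransition.one_of_one_le ?_
    have := Real.log_le_log hm hs
    nlinarith
  · intro s
    rcases lt_or_ge s d with h | h
    · rw [(hev0 s h).deriv_eq]; simp [hκ.le]
    · have hs : 0 < s := hd0.trans_le h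
      rw [(hev s hs).deriv_eq, (hφd s hs).deriv]
      refine le_trans (le_of_eq ?_) ((pow_le_pow_left₀ (by positivity)
        (mul_le_mul_of_nonneg_right (hL' (1 + t * (Real.log s - Real.log m))) ht.le) 2).trans htκ)
      rw [mul_pow |_| t, sq_abs]
      field_simp
  · intro a b ha hb
    rw [hpos a ha, hpos b hb]
    have h1 : |φ a - φ b| ≤ L * t * |Real.log a - Real.log b| := by
      refine (hL _ _).trans_eq ?_
      rw [show 1 + t * (Real.log a - Real.log m) - (1 + t * (Real.log b - Real.log m)) =
        t * (Real.log a - Real.log b) by ring, abs_mul, abs_of_pos ht]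
      ring
    have h2 : a * b * (Real.log a - Real.log b) ^ 2 ≤ (a - b) ^ 2 := mul_sq_log_sub_log_le ha hb
    have h3 : (φ a - φ b) ^ 2 ≤ (L * t) ^ 2 * (Real.log a - Real.log b) ^ 2 := by
      rw [← sq_abs, ← sq_abs (Real.log a - Real.log b), ← mul_pow]
      gcongr
    calc a * b * (φ a - φ b) ^ 2
        ≤ a * b * ((L * t) ^ 2 * (Real.log a - Real.log b) ^ 2) := by gcongr
      _ = (L * t) ^ 2 * (a * b * (Real.log a - Real.log b) ^ 2) := by ring
      _ ≤ κ * (a - b) ^ 2 := by gcongr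

end JumpDiffusion

/-! ### The stability form on functions with disjoint supports. -/

namespace JumpDiffusion

variable {n : ℕ} {J : Euc n → ℝ} {c : ℝ}

/-- At each point one of the functions vanishes, hence attains its minimum there and has zero
gradient. -/
theorem inner_gradient_eq_zero_of_mul_eq_zero {a b : Euc n → ℝ} (ha : ∀ x, 0 ≤ a x)
    (hb : ∀ x, 0 ≤ b x) (hab : ∀ x, a x * b x = 0) (x : Euc n) :
    inner ℝ (∇ a x) (∇ b x) = 0 := by
  have key : ∀ d : Euc n → ℝ, (∀ x, 0 ≤ d x) → d x = 0 → ∇ d x = 0 := by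
    intro d hd hx
    have hmin : IsLocalMin d x := Eventually.of_forall fun y => by rw [hx]; exact hd y
    rw [gradient, hmin.fderiv_eq_zero, map_zero]
  rcases mul_eq_zero.1 (hab x) with h | h
  · rw [key a ha h, inner_zero_left]
  · rw [key b hb h, inner_zero_right]

theorem energy_integrand_of_mul_eq_zero {a b : Euc n → ℝ} (hab : ∀ x, a x * b x = 0)
    (p : Euc n × Euc n) : (a p.1 - a p.2) * (b p.1 - b p.2) * J (p.1 - p.2) =
      -((a p.1 * b p.2 + a p.2 * b p.1) * J (p.1 - p.2)) := by
  linear_combination J (p.1 - p.2) * (hab p.1 + hab p.2)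

theorem energy_nonpos_of_mul_eq_zero (hJ : IsJumpKernel J) {a b : Euc n → ℝ} (ha : ∀ x, 0 ≤ a x)
    (hb : ∀ x, 0 ≤ b x) (hab : ∀ x, a x * b x = 0) : energy J a b ≤ 0 := by
  refine integral_nonpos fun p => ?_
  rw [Pi.zero_apply, energy_integrand_of_mul_eq_zero hab, neg_nonpos]
  exact mul_nonneg (add_nonneg (mul_nonneg (ha _) (hb _)) (mul_nonneg (ha _) (hb _))) (hJ.nonneg _)

/-- This is the nonlocal interaction that drives the whole argument. The integrand of `-energy` is
nonnegative, and positive on the nonempty open set of pairs with `a(x) > 0`, `b(y) > 0`, `‖x - y‖ <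
δ`; such pairs are off the diagonal because `a b = 0`. -/
theorem energy_neg_of_mul_eq_zero (hJ : IsJumpKernel J)
    (hk : Integrable fun z : Euc n => ‖z‖ ^ 2 * J z) {δ : ℝ}
    (hpos : ∀ z : Euc n, 0 < ‖z‖ → ‖z‖ ≤ δ → 0 < J z) {a b : Euc n → ℝ} (hta : IsTest a)
    (htb : IsTest b) (ha : ∀ x, 0 ≤ a x) (hb : ∀ x, 0 ≤ b x) (hab : ∀ x, a x * b x = 0)
    {x₀ y₀ : Euc n} (hx₀ : 0 < a x₀) (hy₀ : 0 < b y₀) (hxy : ‖x₀ - y₀‖ < δ) :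
    energy J a b < 0 := by
  have hI := (hta.integrable_energy hJ hk htb).neg
  suffices h : 0 < ∫ p : Euc n × Euc n, -((a p.1 - a p.2) * (b p.1 - b p.2) * J (p.1 - p.2)) by
    rw [integral_neg] at h
    exact neg_pos.1 h
  refine (integral_pos_iff_support_of_nonneg (fun p => ?_) hI).2 ?_
  · rw [Pi.zero_apply, Pi.neg_apply, energy_integrand_of_mul_eq_zero hab, neg_neg]
    exact mul_nonneg (add_nonneg (mul_nonneg (ha _) (hb _)) (mul_nonneg (ha _) (hb _)))
      (hJ.nonneg _)
  · have hac := hta.continuous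
    have hbc := htb.continuous
    let U : Set (Euc n × Euc n) := {p | 0 < a p.1} ∩ {p | 0 < b p.2} ∩ {p | ‖p.1 - p.2‖ < δ}
    have hU : IsOpen U :=
      ((isOpen_lt continuous_const (by fun_prop)).inter
        (isOpen_lt continuous_const (by fun_prop))).inter
        (isOpen_lt (by fun_prop) continuous_const)
    have hUne : U.Nonempty := ⟨(x₀, y₀), ⟨hx₀, hy₀⟩, hxy⟩
    have hUpos : 0 < volume U := by
      rw [Measure.volume_eq_prod]
      exact hU.measure_pos _ hUne
    refine hUpos.trans_le (measure_mono ?_)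
    rintro p ⟨⟨h1, h2⟩, h3⟩
    have h1' : 0 < a p.1 := h1
    have h2' : 0 < b p.2 := h2
    have h3' : ‖p.1 - p.2‖ < δ := h3
    have hne : p.1 ≠ p.2 := by
      intro h
      rw [← h] at h2'
      exact (mul_pos h1' h2').ne' (hab _)
    have hJp := hpos (p.1 - p.2) (norm_pos_iff.2 (sub_ne_zero.2 hne)) h3'.le
    rw [Function.mem_support, Pi.neg_apply, energy_integrand_of_mul_eq_zero hab, neg_neg]
    have h4 : 0 ≤ a p.2 * b p.1 := mul_nonneg (ha _) (hb _)
    positivity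

/-- The stability inequality tested with `w η + t ψ`, where `w η` and `ψ` are nonnegative with
disjoint supports and `w` is a weak solution. -/
theorem IsStable.le_of_disjoint (hJ : IsJumpKernel J)
    (hk : Integrable fun z : Euc n => ‖z‖ ^ 2 * J z) {f : ℝ → ℝ} {u : Euc n → ℝ}
    (hs : IsStable J c f u) (hfu : Continuous fun x => deriv f (u x)) {w g η ψ : Euc n → ℝ}
    (h : IsWeakSolution J c w g) (hw : ContDiff ℝ 1 w) (hM : ∃ M, ∀ x, |w x| ≤ M)
    (hg : Continuous g) (hη : IsTest η) (hψ : IsTest ψ) (hwη0 : ∀ x, 0 ≤ w x * η x)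
    (hψ0 : ∀ x, 0 ≤ ψ x) (hd : ∀ x, w x * η x * ψ x = 0) (t : ℝ) :
    -(c * t * energy J (fun x => w x * η x) ψ) ≤
      (∫ x, w x ^ 2 * ‖∇ η x‖ ^ 2) +
        c / 2 * (∫ p : Euc n × Euc n, w p.1 * w p.2 * (η p.1 - η p.2) ^ 2 * J (p.1 - p.2)) +
        (∫ x, (g x * w x - deriv f (u x) * w x ^ 2) * η x ^ 2) +
        t ^ 2 * ((∫ x, ‖∇ ψ x‖ ^ 2) + c / 2 * energy J ψ ψ - ∫ x, deriv f (u x) * ψ x ^ 2) := by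
  set A : Euc n → ℝ := fun x => w x * η x with hA
  have hAt : IsTest A := IsTest.mul_left hw hη
  have hid := h.energy_identity hJ hk hw hM hη
  rw [← hA] at hid
  have hζ : IsTest fun x => A x + t * ψ x := hAt.add (hψ.const_mul t)
  have hst := hs _ hζ.contDiff hζ.compact
  -- Disjointness kills the cross term in the potential and in the Dirichlet integral; only the
  -- nonlocal cross term survives.
  have e1 : ∫ x, deriv f (u x) * (A x + t * ψ x) ^ 2 =
      (∫ x, deriv f (u x) * A x ^ 2) + t ^ 2 * ∫ x, deriv f (u x) * ψ x ^ 2 := by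
    rw [← integral_const_mul, ← integral_add (hAt.sq.integrable_mul hfu)
      ((hψ.sq.integrable_mul hfu).const_mul _)]
    refine integral_congr_ae (Eventually.of_forall fun x => ?_)
    simp only
    linear_combination (2 * t * deriv f (u x)) * hd x
  have e2 : ∫ x, ‖∇ (fun x => A x + t * ψ x) x‖ ^ 2 =
      (∫ x, ‖∇ A x‖ ^ 2) + t ^ 2 * ∫ x, ‖∇ ψ x‖ ^ 2 := by
    rw [← integral_const_mul, ← integral_add hAt.integrable_norm_sq
      (hψ.integrable_norm_sq.const_mul _)]
    refine integral_congr_ae (Eventually.of_forall fun x => ?_)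
    simp only
    rw [gradient_add (hAt.differentiableAt x) ((hψ.const_mul t).differentiableAt x),
      gradient_const_mul t (hψ.differentiableAt x), norm_add_sq_real, real_inner_smul_right,
      inner_gradient_eq_zero_of_mul_eq_zero hwη0 hψ0 hd, norm_smul, mul_pow, Real.norm_eq_abs,
      sq_abs]
    ring
  have e3 : ∫ p : Euc n × Euc n, (A p.1 + t * ψ p.1 - (A p.2 + t * ψ p.2)) ^ 2 * J (p.1 - p.2) =
      energy J A A + 2 * t * energy J A ψ + t ^ 2 * energy J ψ ψ := by
    unfold energy
    have i1 := hAt.integrable_energy hJ hk hAt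
    have i2 := (hAt.integrable_energy hJ hk hψ).const_mul (2 * t)
    have i3 := (hψ.integrable_energy hJ hk hψ).const_mul (t ^ 2)
    rw [← integral_const_mul, ← integral_const_mul, ← integral_add i1 i2,
      ← integral_add (i1.fun_add i2) i3]
    refine integral_congr_ae (Eventually.of_forall fun p => ?_)
    simp only
    ring
  have e4 : ∫ x, (g x * w x - deriv f (u x) * w x ^ 2) * η x ^ 2 =
      (∫ x, g x * (w x * η x ^ 2)) - ∫ x, deriv f (u x) * A x ^ 2 := by
    rw [← integral_sub ((IsTest.mul_left hw hη.sq).integrable_mul hg) (hAt.sq.integrable_mul hfu)]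
    refine integral_congr_ae (Eventually.of_forall fun x => ?_)
    simp only [hA]
    ring
  rw [e1, e2, e3] at hst
  rw [e4]
  linarith

/-! ### Energy cost of the combined cutoff `r(w) η`. -/

section valueCutoff

variable {w η : Euc n → ℝ} {r : ℝ → ℝ} {κ : ℝ}

theorem isTest_valueCutoff (hw : ContDiff ℝ 1 w) (hη : IsTest η) (hr : ContDiff ℝ 1 r) :
    IsTest fun x => r (w x) * η x :=
  IsTest.mul_left (hr.comp hw) hη

/-- Differentiating `r(w)` produces `w r'(w)`, whose square is at most `κ`. The Dirichlet energy
that multiplies `κ` may be large, since `κ` will be chosen after it. -/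
theorem integral_gradient_valueCutoff_le (hw : ContDiff ℝ 1 w) (hη : IsTest η)
    (hr : ContDiff ℝ 1 r) (hr01 : ∀ s, 0 ≤ r s ∧ r s ≤ 1)
    (hrd : ∀ s, (s * deriv r s) ^ 2 ≤ κ) :
    ∫ x, w x ^ 2 * ‖∇ (fun y => r (w y) * η y) x‖ ^ 2 ≤
      2 * (∫ x, w x ^ 2 * ‖∇ η x‖ ^ 2) + 2 * κ * ∫ x, ‖∇ w x‖ ^ 2 * η x ^ 2 := by
  have hw2 : Continuous fun x => w x ^ 2 := hw.continuous.pow 2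
  have hgw : Continuous fun x => ‖∇ w x‖ ^ 2 := (continuous_gradient hw).norm.pow 2
  have hT := isTest_valueCutoff hw hη hr
  rw [← integral_const_mul, ← integral_const_mul,
    ← integral_add ((hη.integrable_mul_norm_sq hw2).const_mul 2)
      ((hη.sq.integrable_mul hgw).const_mul (2 * κ))]
  refine integral_mono (hT.integrable_mul_norm_sq hw2)
    (((hη.integrable_mul_norm_sq hw2).const_mul 2).add
      ((hη.sq.integrable_mul hgw).const_mul (2 * κ))) fun x => ?_
  have hwx := hw.differentiable one_ne_zero x
  have hrx := hr.differentiable one_ne_zero (w x)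
  simp only
  rw [gradient_mul (hrx.fun_comp' x hwx) (hη.differentiableAt x), gradient_real_comp hrx hwx]
  have h1 : ‖r (w x) • ∇ η x + η x • deriv r (w x) • ∇ w x‖ ^ 2 ≤
      2 * (r (w x) ^ 2 * ‖∇ η x‖ ^ 2) + 2 * (η x ^ 2 * (deriv r (w x) ^ 2 * ‖∇ w x‖ ^ 2)) := by
    have h2 := norm_add_le (r (w x) • ∇ η x) (η x • deriv r (w x) • ∇ w x)
    have h3 : ‖r (w x) • ∇ η x‖ ^ 2 = r (w x) ^ 2 * ‖∇ η x‖ ^ 2 := by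
      rw [norm_smul, mul_pow, Real.norm_eq_abs, sq_abs]
    have h4 : ‖η x • deriv r (w x) • ∇ w x‖ ^ 2 =
        η x ^ 2 * (deriv r (w x) ^ 2 * ‖∇ w x‖ ^ 2) := by
      rw [norm_smul, norm_smul, mul_pow, mul_pow, Real.norm_eq_abs, Real.norm_eq_abs, sq_abs,
        sq_abs]
    rw [← h3, ← h4]
    nlinarith [norm_nonneg (r (w x) • ∇ η x + η x • deriv r (w x) • ∇ w x),
      sq_nonneg (‖r (w x) • ∇ η x‖ - ‖η x • deriv r (w x) • ∇ w x‖)]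
  have h5 : r (w x) ^ 2 ≤ 1 := pow_le_one₀ (hr01 _).1 (hr01 _).2
  have h6 := hrd (w x)
  calc w x ^ 2 * ‖r (w x) • ∇ η x + η x • deriv r (w x) • ∇ w x‖ ^ 2
      ≤ w x ^ 2 * (2 * (r (w x) ^ 2 * ‖∇ η x‖ ^ 2) +
          2 * (η x ^ 2 * (deriv r (w x) ^ 2 * ‖∇ w x‖ ^ 2))) := by gcongr
    _ = 2 * (w x ^ 2 * (r (w x) ^ 2 * ‖∇ η x‖ ^ 2)) +
          2 * ((w x * deriv r (w x)) ^ 2 * (‖∇ w x‖ ^ 2 * η x ^ 2)) := by ring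
    _ ≤ 2 * (w x ^ 2 * (1 * ‖∇ η x‖ ^ 2)) + 2 * (κ * (‖∇ w x‖ ^ 2 * η x ^ 2)) := by gcongr
    _ = _ := by ring

theorem integrable_sub_sq_mul_sq (hJ : IsJumpKernel J)
    (hk : Integrable fun z : Euc n => ‖z‖ ^ 2 * J z) (hw : ContDiff ℝ 1 w)
    (hM : ∃ M, ∀ x, |w x| ≤ M) (hη : IsTest η) :
    Integrable fun p : Euc n × Euc n => (w p.1 - w p.2) ^ 2 * η p.2 ^ 2 * J (p.1 - p.2) := by
  obtain ⟨M, hM⟩ := hM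
  obtain ⟨R, -, hR⟩ := hη.exists_support_subset
  obtain ⟨C, hC0, hC⟩ := exists_lipschitz_from_ball hw hM R
  obtain ⟨B, hB⟩ := hη.exists_bound
  have hwc := hw.continuous
  have hηc := hη.continuous
  refine integrable_of_le_ball_kernel hJ hk (C := C ^ 2 * B ^ 2) (R := R) ?_ ?_ ?_
  · exact (by fun_prop : Continuous fun p : Euc n × Euc n =>
      (w p.1 - w p.2) ^ 2 * η p.2 ^ 2).measurable.mul hJ.measurable_sub
  · intro x y
    rw [abs_of_nonneg (mul_nonneg (by positivity) (hJ.nonneg _))]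
    refine mul_le_mul_of_nonneg_right ?_ (hJ.nonneg _)
    by_cases hy : η y = 0
    · simp only [hy]
      norm_num
      positivity
    · have h1 := hC y (hR y hy) x
      rw [abs_sub_comm, norm_sub_rev] at h1
      calc (w x - w y) ^ 2 * η y ^ 2 = |w x - w y| ^ 2 * |η y| ^ 2 := by rw [sq_abs, sq_abs]
        _ ≤ (C * ‖x - y‖) ^ 2 * B ^ 2 := by gcongr; exact hB y
        _ = _ := by ring
  · intro x y _ hy
    simp [not_imp_comm.1 (hR y) hy]

/-- The factor `w(x) w(y)` makes pairs of opposite sign contribute nonpositively, and two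
nonpositive values are annihilated by `r`. For positive values `a, b`, the splitting `r(a) x - r(b)
y = r(a)(x - y) + (r(a) - r(b)) y` separates the cost of `η` from that of `r`. -/
theorem integral_energy_valueCutoff_le (hJ : IsJumpKernel J)
    (hk : Integrable fun z : Euc n => ‖z‖ ^ 2 * J z) (hw : ContDiff ℝ 1 w)
    (hM : ∃ M, ∀ x, |w x| ≤ M) (hη : IsTest η) (hr : ContDiff ℝ 1 r)
    (hr01 : ∀ s, 0 ≤ r s ∧ r s ≤ 1) (hr0 : ∀ s, s ≤ 0 → r s = 0) (hκ : 0 ≤ κ)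
    (hrl : ∀ a b, 0 < a → 0 < b → a * b * (r a - r b) ^ 2 ≤ κ * (a - b) ^ 2)
    (hi : Integrable fun p : Euc n × Euc n =>
      w p.2 ^ 2 * (η p.1 - η p.2) ^ 2 * J (p.1 - p.2)) :
    ∫ p : Euc n × Euc n, w p.1 * w p.2 * (r (w p.1) * η p.1 - r (w p.2) * η p.2) ^ 2 *
        J (p.1 - p.2) ≤
      2 * (∫ p : Euc n × Euc n, w p.2 ^ 2 * (η p.1 - η p.2) ^ 2 * J (p.1 - p.2)) +
        2 * κ * ∫ p : Euc n × Euc n, (w p.1 - w p.2) ^ 2 * η p.2 ^ 2 * J (p.1 - p.2) := by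
  have hi' := integrable_prod_swap hi
  have hE := integrable_sub_sq_mul_sq hJ hk hw hM hη
  have hswap := integral_prod_swap_eq (n := n) fun p =>
    w p.2 ^ 2 * (η p.1 - η p.2) ^ 2 * J (p.1 - p.2)
  have hpt : ∀ p : Euc n × Euc n,
      w p.1 * w p.2 * (r (w p.1) * η p.1 - r (w p.2) * η p.2) ^ 2 * J (p.1 - p.2) ≤
        w p.2 ^ 2 * (η p.1 - η p.2) ^ 2 * J (p.1 - p.2) +
        w p.swap.2 ^ 2 * (η p.swap.1 - η p.swap.2) ^ 2 * J (p.swap.1 - p.swap.2) +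
        2 * κ * ((w p.1 - w p.2) ^ 2 * η p.2 ^ 2 * J (p.1 - p.2)) := by
    intro p
    rw [Prod.fst_swap, Prod.snd_swap, hJ.sub_comm p.2 p.1]
    have hJ0 := hJ.nonneg (p.1 - p.2)
    generalize J (p.1 - p.2) = j at hJ0 ⊢
    generalize w p.1 = a
    generalize w p.2 = b
    generalize η p.1 = x
    generalize η p.2 = y
    have main : a * b * (r a * x - r b * y) ^ 2 ≤
        b ^ 2 * (x - y) ^ 2 + a ^ 2 * (y - x) ^ 2 + 2 * κ * ((a - b) ^ 2 * y ^ 2) := by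
      have hR : 0 ≤ b ^ 2 * (x - y) ^ 2 + a ^ 2 * (y - x) ^ 2 + 2 * κ * ((a - b) ^ 2 * y ^ 2) := by
        positivity
      rcases le_or_gt a 0 with ha | ha
      · rcases le_or_gt b 0 with hb | hb
        · rw [hr0 a ha, hr0 b hb]; simpa using hR
        · refine le_trans ?_ hR
          exact mul_nonpos_of_nonpos_of_nonneg (mul_nonpos_of_nonpos_of_nonneg ha hb.le)
            (sq_nonneg _)
      · rcases le_or_gt b 0 with hb | hb
        · refine le_trans ?_ hR
          exact mul_nonpos_of_nonpos_of_nonneg (mul_nonpos_of_nonneg_of_nonpos ha.le hb)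
            (sq_nonneg _)
        · have h1 := mul_le_mul_of_nonneg_right (hrl a b ha hb) (sq_nonneg y)
          have h2 : (r a * x - r b * y) ^ 2 ≤ 2 * (x - y) ^ 2 + 2 * ((r a - r b) ^ 2 * y ^ 2) := by
            have h3 : r a ^ 2 ≤ 1 := pow_le_one₀ (hr01 _).1 (hr01 _).2
            have h4 : r a ^ 2 * (x - y) ^ 2 ≤ 1 * (x - y) ^ 2 := by gcongr
            have h5 : r a * x - r b * y = r a * (x - y) + (r a - r b) * y := by ring
            rw [h5]
            nlinarith [sq_nonneg (r a * (x - y) - (r a - r b) * y)]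
          have h6 : 2 * (a * b) * (x - y) ^ 2 ≤ (a ^ 2 + b ^ 2) * (x - y) ^ 2 := by
            gcongr; nlinarith [sq_nonneg (a - b)]
          have h7 := mul_le_mul_of_nonneg_left h2 (mul_pos ha hb).le
          nlinarith
    have := mul_le_mul_of_nonneg_right main hJ0
    linarith
  have hT := isTest_valueCutoff hw hη hr
  calc _ ≤ ∫ p : Euc n × Euc n, (w p.2 ^ 2 * (η p.1 - η p.2) ^ 2 * J (p.1 - p.2) +
        w p.swap.2 ^ 2 * (η p.swap.1 - η p.swap.2) ^ 2 * J (p.swap.1 - p.swap.2) +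
        2 * κ * ((w p.1 - w p.2) ^ 2 * η p.2 ^ 2 * J (p.1 - p.2))) :=
        integral_mono (integrable_weight_energy hJ hk hw.continuous hM hT)
          ((hi.add hi').add (hE.const_mul _)) hpt
    _ = _ := by
        rw [integral_add (hi.fun_add hi') (hE.const_mul _), integral_const_mul,
          integral_add hi hi', hswap]
        ring

end valueCutoff

end JumpDiffusion

/-! ### Second and third moments of the kernel. -/

namespace JumpDiffusion

theorem lintegral_cube_outside_le {J : Euc 2 → ℝ} {C δ₀ θ : ℝ} (hδ₀ : 0 < δ₀) (hθ : 3 < θ)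
    (hC : 0 ≤ C)
    (h : ∀ r : ℝ, δ₀ < r → ∫⁻ z in {z : Euc 2 | r < ‖z‖ ∧ ‖z‖ < 2 * r}, ENNReal.ofReal (J z) ≤
      ENNReal.ofReal (C * r ^ (-θ))) {s : ℝ} (hs : δ₀ < s) :
    ∫⁻ z in {z : Euc 2 | s < ‖z‖}, ENNReal.ofReal (‖z‖ ^ 3 * J z) ≤
      ENNReal.ofReal (∑' k : ℕ, 8 * C * δ₀ ^ (3 - θ) * ((3 / 2 : ℝ) ^ (3 - θ)) ^ k) := by
  have hs0 : 0 < s := hδ₀.trans hs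
  -- Ratio `3/2` rather than `2` makes the open annuli overlap, so no sphere is missed. The masses
  -- form a geometric series because `θ > 3`.
  let A : ℕ → Set (Euc 2) := fun k =>
    {z : Euc 2 | s * (3 / 2) ^ k < ‖z‖ ∧ ‖z‖ < 2 * (s * (3 / 2) ^ k)}
  have hcover : {z : Euc 2 | s < ‖z‖} ⊆ ⋃ k, A k := by
    intro z hz
    have hz' : s < ‖z‖ := hz
    obtain ⟨k, hk1, hk2⟩ := exists_mem_Ioc_zpow (x := ‖z‖ / s) (y := (3 / 2 : ℝ))
      (div_pos (hs0.trans hz') hs0) (by norm_num)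
    have hk0 : 0 ≤ k := by
      by_contra hneg
      have h1 : (3 / 2 : ℝ) ^ (k + 1) ≤ 1 := zpow_le_one_of_nonpos₀ (by norm_num) (by omega)
      have h2 : 1 < ‖z‖ / s := (one_lt_div hs0).2 hz'
      linarith
    lift k to ℕ using hk0
    rw [zpow_natCast, lt_div_iff₀ hs0] at hk1
    have hk3 : ‖z‖ / s ≤ (3 / 2 : ℝ) ^ (k + 1) := by exact_mod_cast hk2
    rw [div_le_iff₀ hs0, pow_succ] at hk3
    refine Set.mem_iUnion.2 ⟨k, ?_, ?_⟩
    · linarith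
    · have : 0 < (3 / 2 : ℝ) ^ k * s := by positivity
      linarith
  have hterm : ∀ k, ∫⁻ z in A k, ENNReal.ofReal (‖z‖ ^ 3 * J z) ≤
      ENNReal.ofReal (8 * C * δ₀ ^ (3 - θ) * ((3 / 2 : ℝ) ^ (3 - θ)) ^ k) := by
    intro k
    set r := s * (3 / 2 : ℝ) ^ k with hr
    have hrs : s ≤ r := le_mul_of_one_le_right hs0.le (one_le_pow₀ (by norm_num))
    have hr0 : 0 < r := hs0.trans_le hrs
    have hAm : MeasurableSet (A k) :=
      ((isOpen_lt continuous_const continuous_norm).inter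
        (isOpen_lt continuous_norm continuous_const)).measurableSet
    calc ∫⁻ z in A k, ENNReal.ofReal (‖z‖ ^ 3 * J z)
        ≤ ∫⁻ z in A k, ENNReal.ofReal ((2 * r) ^ 3) * ENNReal.ofReal (J z) := by
          refine setLIntegral_mono' hAm fun z hz => ?_
          rw [ENNReal.ofReal_mul (by positivity)]
          gcongr
          exact hz.2.le
      _ = ENNReal.ofReal ((2 * r) ^ 3) * ∫⁻ z in A k, ENNReal.ofReal (J z) :=
          lintegral_const_mul' _ _ ENNReal.ofReal_ne_top
      _ ≤ ENNReal.ofReal ((2 * r) ^ 3) * ENNReal.ofReal (C * r ^ (-θ)) := by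
          gcongr
          exact h r (hs.trans_le hrs)
      _ = ENNReal.ofReal (8 * C * r ^ (3 - θ)) := by
          rw [← ENNReal.ofReal_mul (by positivity), sub_eq_add_neg, Real.rpow_add hr0]
          congr 1
          rw [show (3 : ℝ) = ((3 : ℕ) : ℝ) by norm_num, Real.rpow_natCast]
          ring
      _ ≤ _ := by
          refine ENNReal.ofReal_le_ofReal ?_
          rw [hr, Real.mul_rpow hs0.le (by positivity), mul_assoc (8 * C), ← Real.rpow_natCast,
            ← Real.rpow_natCast, ← Real.rpow_mul (by norm_num), ← Real.rpow_mul (by norm_num),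
            mul_comm (k : ℝ)]
          gcongr 8 * C * (?_ * _)
          exact Real.rpow_le_rpow_of_nonpos hδ₀ hs.le (by linarith)
  have hq0 : 0 ≤ (3 / 2 : ℝ) ^ (3 - θ) := by positivity
  have hq1 : (3 / 2 : ℝ) ^ (3 - θ) < 1 :=
    Real.rpow_lt_one_of_one_lt_of_neg (by norm_num) (by linarith)
  calc ∫⁻ z in {z : Euc 2 | s < ‖z‖}, ENNReal.ofReal (‖z‖ ^ 3 * J z)
      ≤ ∫⁻ z in ⋃ k, A k, ENNReal.ofReal (‖z‖ ^ 3 * J z) := lintegral_mono_set hcover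
    _ ≤ ∑' k, ∫⁻ z in A k, ENNReal.ofReal (‖z‖ ^ 3 * J z) := lintegral_iUnion_le _ _
    _ ≤ ∑' k : ℕ, ENNReal.ofReal (8 * C * δ₀ ^ (3 - θ) * ((3 / 2 : ℝ) ^ (3 - θ)) ^ k) :=
        ENNReal.tsum_le_tsum hterm
    _ = _ := (ENNReal.ofReal_tsum_of_nonneg (fun k => by positivity)
        ((summable_geometric_of_lt_one hq0 hq1).mul_left _)).symm

theorem integrable_moments {J : Euc 2 → ℝ} (hJ : IsJumpKernel J) {lam Lam α β δ₀ : ℝ}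
    (hα2 : α < 2) (hδ₀ : 0 < δ₀) (hJnear : ComparableNearOrigin J lam Lam α β δ₀)
    {D : ℝ → ℝ} (hDnonneg : ∀ r : ℝ, 0 < r → 0 ≤ D r) {C₁ C₂ θ : ℝ} (hθ : 3 < θ)
    (hJdecay : AnnulusDecay J C₁ D δ₀) (hD : ∀ r : ℝ, δ₀ < r → D r < C₂ * r ^ (-θ)) :
    Integrable (fun z : Euc 2 => ‖z‖ ^ 2 * J z) ∧ Integrable (fun z : Euc 2 => ‖z‖ ^ 3 * J z) := by
  have hJm := hJ.measurable
  have hann : ∀ r : ℝ, δ₀ < r → ∫⁻ z in {z : Euc 2 | r < ‖z‖ ∧ ‖z‖ < 2 * r},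
      ENNReal.ofReal (J z) ≤ ENNReal.ofReal (|C₁| * |C₂| * r ^ (-θ)) := by
    intro r hr
    have hr0 : 0 < r := hδ₀.trans hr
    refine (hJdecay r hr).trans (ENNReal.ofReal_le_ofReal ?_)
    have h1 : D r ≤ |C₂| * r ^ (-θ) := (hD r hr).le.trans (by gcongr; exact le_abs_self _)
    calc C₁ * D r ≤ |C₁| * D r := by gcongr; exacts [hDnonneg r hr0, le_abs_self _]
      _ ≤ |C₁| * (|C₂| * r ^ (-θ)) := by gcongr
      _ = _ := by ring
  have hfar : IntegrableOn (fun z : Euc 2 => ‖z‖ ^ 3 * J z) {z : Euc 2 | δ₀ < ‖z‖} := by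
    refine ⟨(by fun_prop : Measurable fun z : Euc 2 => ‖z‖ ^ 3 * J z).aestronglyMeasurable, ?_⟩
    rw [hasFiniteIntegral_iff_ofReal
      (Eventually.of_forall fun z => mul_nonneg (by positivity) (hJ.nonneg z))]
    -- The annulus bound is available only for radii strictly above `δ₀`. The estimate is uniform in
    -- the starting radius, so the region is exhausted from inside.
    have hU : {z : Euc 2 | δ₀ < ‖z‖} = ⋃ k : ℕ, {z : Euc 2 | δ₀ + 1 / ((k : ℝ) + 1) < ‖z‖} := by
      ext z
      simp only [Set.mem_iUnion]
      constructor
      · intro hz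
        obtain ⟨k, hk⟩ := exists_nat_one_div_lt (sub_pos.2 (show δ₀ < ‖z‖ from hz))
        exact ⟨k, by show δ₀ + 1 / ((k : ℝ) + 1) < ‖z‖; linarith⟩
      · rintro ⟨k, hk⟩
        have hk' : δ₀ + 1 / ((k : ℝ) + 1) < ‖z‖ := hk
        have : (0 : ℝ) < 1 / ((k : ℝ) + 1) := by positivity
        show δ₀ < ‖z‖
        linarith
    rw [hU, setLIntegral_iUnion_of_directed]
    · refine lt_of_le_of_lt (iSup_le fun k => lintegral_cube_outside_le hδ₀ hθ (by positivity) hann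
        (s := δ₀ + 1 / ((k : ℝ) + 1)) ?_) ENNReal.ofReal_lt_top
      have : (0 : ℝ) < 1 / ((k : ℝ) + 1) := by positivity
      linarith
    · refine Monotone.directed_le fun i j hij z hz => ?_
      have hz' : δ₀ + 1 / ((i : ℝ) + 1) < ‖z‖ := hz
      have : 1 / ((j : ℝ) + 1) ≤ 1 / ((i : ℝ) + 1) := by gcongr
      show δ₀ + 1 / ((j : ℝ) + 1) < ‖z‖
      linarith
  have hnear : IntegrableOn (fun z : Euc 2 => ‖z‖ ^ 2 * J z) {z : Euc 2 | ‖z‖ ≤ δ₀} := by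
    -- Near the origin `‖z‖² J ≤ Lam ‖z‖^(-α)`, integrable in the plane since `α < 2`.
    have hrad : IntegrableOn (fun z : Euc 2 => Lam * ‖z‖ ^ (-α)) (Metric.ball (0 : Euc 2) (2 * δ₀)) := by
      refine (integrableOn_fun_norm_addHaar (volume : Measure (Euc 2))
        (f := fun r => Lam * r ^ (-α))).2 ?_
      have h1 : IntegrableOn (fun r : ℝ => Lam * r ^ (1 - α)) (Set.Ioo 0 (2 * δ₀)) :=
        ((intervalIntegral.integrableOn_Ioo_rpow_iff (by positivity)).2 (by linarith)).const_mul Lam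
      refine h1.congr_fun (fun r hr => ?_) measurableSet_Ioo
      have hr0 : 0 < r := hr.1
      simp only [finrank_euclideanSpace, Fintype.card_fin, Nat.add_one_sub_one, pow_one,
        smul_eq_mul]
      rw [sub_eq_add_neg, Real.rpow_add hr0, Real.rpow_one]
      ring
    have hsub : {z : Euc 2 | ‖z‖ ≤ δ₀} ⊆ Metric.ball (0 : Euc 2) (2 * δ₀) := fun z hz => by
      have hz' : ‖z‖ ≤ δ₀ := hz
      rw [mem_ball_zero_iff]
      linarith
    refine Integrable.mono' (hrad.mono_set hsub)
      (by fun_prop : Measurable fun z : Euc 2 => ‖z‖ ^ 2 * J z).aestronglyMeasurable ?_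
    refine (ae_restrict_iff' (isClosed_le continuous_norm continuous_const).measurableSet).2 ?_
    filter_upwards [compl_mem_ae_iff.2 (measure_singleton (0 : Euc 2))] with z hz0 hz
    have hz0' : 0 < ‖z‖ := norm_pos_iff.2 hz0
    rw [Real.norm_of_nonneg (mul_nonneg (by positivity) (hJ.nonneg z))]
    calc ‖z‖ ^ 2 * J z ≤ ‖z‖ ^ 2 * (Lam / ‖z‖ ^ (((2 : ℕ) : ℝ) + α)) := by
          gcongr; exact (hJnear z hz0' hz).2
      _ = Lam * ‖z‖ ^ (-α) := by
          rw [Real.rpow_add hz0', Real.rpow_natCast, Real.rpow_neg hz0'.le]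
          field_simp
  have hunion : {z : Euc 2 | ‖z‖ ≤ δ₀} ∪ {z : Euc 2 | δ₀ < ‖z‖} = Set.univ := by
    ext z
    simp only [Set.mem_union, Set.mem_univ, iff_true]
    exact le_or_gt ‖z‖ δ₀
  have hmle : MeasurableSet {z : Euc 2 | ‖z‖ ≤ δ₀} :=
    (isClosed_le continuous_norm continuous_const).measurableSet
  constructor
  · rw [← integrableOn_univ, ← hunion]
    refine hnear.union (Integrable.mono' (hfar.const_mul δ₀⁻¹)
      (by fun_prop : Measurable fun z : Euc 2 => ‖z‖ ^ 2 * J z).aestronglyMeasurable ?_)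
    refine (ae_restrict_iff' (measurableSet_norm_gt δ₀)).2 (Eventually.of_forall fun z hz => ?_)
    have hz' : δ₀ < ‖z‖ := hz
    rw [Real.norm_of_nonneg (mul_nonneg (by positivity) (hJ.nonneg z)), ← mul_assoc]
    refine mul_le_mul_of_nonneg_right ?_ (hJ.nonneg z)
    rw [inv_mul_eq_div, le_div_iff₀ hδ₀]
    nlinarith [sq_nonneg ‖z‖]
  · rw [← integrableOn_univ, ← hunion]
    refine IntegrableOn.union (Integrable.mono' (hnear.const_mul δ₀)
      (by fun_prop : Measurable fun z : Euc 2 => ‖z‖ ^ 3 * J z).aestronglyMeasurable ?_) hfar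
    refine (ae_restrict_iff' hmle).2 (Eventually.of_forall fun z hz => ?_)
    have hz' : ‖z‖ ≤ δ₀ := hz
    rw [Real.norm_of_nonneg (mul_nonneg (by positivity) (hJ.nonneg z)), ← mul_assoc]
    refine mul_le_mul_of_nonneg_right ?_ (hJ.nonneg z)
    nlinarith [sq_nonneg ‖z‖]

end JumpDiffusion

/-! ### Propagation of the sign of a directional derivative. -/

namespace JumpDiffusion

variable {n : ℕ} {J : Euc n → ℝ} {c : ℝ}

/-- The difference quotient of `f ∘ u` is asymptotically `f'(u)` times the one of `u`. -/
theorem exists_diffQuot_error_le {f : ℝ → ℝ} (hf : ContDiff ℝ 1 f) {u : Euc n → ℝ}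
    (hu : ContDiff ℝ 1 u) (hM : ∃ M, ∀ x, |u x| ≤ M) (e : Euc n) (R : ℝ) {s : ℝ} (hs : 0 < s) :
    ∃ h₀, 0 < h₀ ∧ ∀ h, 0 < h → h ≤ h₀ → ∀ x : Euc n, ‖x‖ ≤ R →
      |h⁻¹ * (f (u (x + h • e)) - f (u x)) * diffQuot u e h x -
        deriv f (u x) * diffQuot u e h x ^ 2| ≤ s := by
  obtain ⟨M, hM⟩ := hM
  have hd := hu.differentiable one_ne_zero
  have hfd := hf.differentiable one_ne_zero
  have hcont : Continuous fun y => fderiv ℝ u y e :=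
    (hu.continuous_fderiv one_ne_zero).clm_apply continuous_const
  obtain ⟨B, hB⟩ := (isCompact_closedBall (0 : Euc n) (R + ‖e‖)).exists_bound_of_continuousOn
    hcont.continuousOn
  have huc := isCompact_Icc (a := -M) (b := M) |>.uniformContinuousOn_of_continuous
    (hf.continuous_deriv le_rfl).continuousOn
  obtain ⟨δ, hδ, hδ'⟩ := Metric.uniformContinuousOn_iff.1 huc (s / (B ^ 2 + 1)) (by positivity)
  -- The bound `1` keeps the segment from `x` to `x + h e` where the directional derivative is at
  -- most `B`; the other bound keeps the increment of `u` below the modulus `δ` for `f'`.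
  refine ⟨min 1 (δ / (2 * (|B| + 1))), by positivity, fun h hh hh0 x hx => ?_⟩
  have hh1 : h ≤ 1 := hh0.trans (min_le_left _ _)
  have hh2 : h * (2 * (|B| + 1)) ≤ δ :=
    (le_div_iff₀ (by positivity)).1 (hh0.trans (min_le_right _ _))
  set w := diffQuot u e h x with hw
  have hwB : |w| ≤ B := by
    obtain ⟨t, ht, hte⟩ := exists_diffQuot_eq hd e hh x
    rw [hw, hte]
    refine hB _ ?_
    rw [mem_closedBall_zero_iff]
    refine (norm_add_le _ _).trans (add_le_add hx ?_)
    rw [norm_smul, Real.norm_of_nonneg ht.1]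
    exact mul_le_of_le_one_left (norm_nonneg _) (ht.2.trans hh1)
  have hB0 : 0 ≤ B := (abs_nonneg _).trans hwB
  have hΔ : u (x + h • e) - u x = h * w := by
    rw [hw, diffQuot]; field_simp
  have hΔδ : |u (x + h • e) - u x| < δ := by
    rw [hΔ, abs_mul, abs_of_pos hh]
    rw [abs_of_nonneg hB0] at hh2
    nlinarith
  have hmem : ∀ y ∈ Set.uIcc (u x) (u (x + h • e)), y ∈ Set.Icc (-M) M :=
    fun y hy => Set.uIcc_subset_Icc (abs_le.1 (hM x)) (abs_le.1 (hM (x + h • e))) hy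
  have hder : ∀ y ∈ Set.uIcc (u x) (u (x + h • e)), HasDerivWithinAt
      (fun y => f y - deriv f (u x) * y) (deriv f y - deriv f (u x))
      (Set.uIcc (u x) (u (x + h • e))) y := by
    intro y _
    have := (hfd y).hasDerivAt.sub ((hasDerivAt_id y).const_mul (deriv f (u x)))
    rw [mul_one] at this
    exact this.hasDerivWithinAt
  have hbd : ∀ y ∈ Set.uIcc (u x) (u (x + h • e)),
      ‖deriv f y - deriv f (u x)‖ ≤ s / (B ^ 2 + 1) := by
    intro y hy
    refine (hδ' y (hmem y hy) (u x) (abs_le.1 (hM x)) ?_).le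
    exact (Set.abs_sub_left_of_mem_uIcc hy).trans_lt hΔδ
  have key := (convex_uIcc (u x) (u (x + h • e))).norm_image_sub_le_of_norm_hasDerivWithin_le hder
    hbd Set.left_mem_uIcc Set.right_mem_uIcc
  rw [Real.norm_eq_abs, Real.norm_eq_abs, hΔ, abs_mul, abs_of_pos hh] at key
  have e1 : h⁻¹ * (f (u (x + h • e)) - f (u x)) * w - deriv f (u x) * w ^ 2 =
      h⁻¹ * w * (f (u (x + h • e)) - deriv f (u x) * u (x + h • e) -
        (f (u x) - deriv f (u x) * u x)) := by
    have : u (x + h • e) = u x + h * w := by linarith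
    rw [this]
    field_simp
    ring
  rw [e1, abs_mul, abs_mul, abs_of_pos (inv_pos.2 hh)]
  calc h⁻¹ * |w| * _ ≤ h⁻¹ * |w| * (s / (B ^ 2 + 1) * (h * |w|)) := by gcongr
    _ = s / (B ^ 2 + 1) * |w| ^ 2 := by field_simp
    _ ≤ s / (B ^ 2 + 1) * B ^ 2 := by gcongr
    _ ≤ s := by
        rw [div_mul_eq_mul_div, div_le_iff₀ (by positivity)]
        nlinarith

set_option maxHeartbeats 1000000 in
/-- Propagation of the sign of a directional derivative over distances less than `δ`. -/
theorem fderiv_nonpos_propagates {J : Euc 2 → ℝ} (hJ : IsJumpKernel J)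
    (hk : Integrable fun z : Euc 2 => ‖z‖ ^ 2 * J z)
    (hk' : Integrable fun z : Euc 2 => ‖z‖ ^ 3 * J z) {δ : ℝ}
    (hpos : ∀ z : Euc 2, 0 < ‖z‖ → ‖z‖ ≤ δ → 0 < J z) (hc : 0 < c) {f : ℝ → ℝ}
    (hf : ContDiff ℝ 1 f) {u : Euc 2 → ℝ} (hbdd : ∃ M, ∀ x, |u x| ≤ M)
    (hsol : IsSolution J c f u) (hstab : IsStable J c f u) (e y₀ : Euc 2)
    (hy₀ : ∀ᶠ y in 𝓝 y₀, fderiv ℝ u y e ≤ 0) (x₀ : Euc 2) (hxy : ‖x₀ - y₀‖ < δ) :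
    fderiv ℝ u x₀ e ≤ 0 := by
  by_contra! hx₀
  have hu : ContDiff ℝ 1 u := hsol.1.of_le (by norm_num)
  have hd := hu.differentiable one_ne_zero
  have hcont : Continuous fun y => fderiv ℝ u y e :=
    (hu.continuous_fderiv one_ne_zero).clm_apply continuous_const
  have hfu : Continuous fun x => deriv f (u x) := (hf.continuous_deriv le_rfl).comp hu.continuous
  have hweak := hsol.isWeakSolution hJ hk hf.continuous hbdd
  obtain ⟨K₀, hK₀⟩ : ∃ K, ∀ a, ∫ x in Metric.closedBall a 1, ‖∇ u x‖ ^ 2 ≤ K := by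
    obtain ⟨M, hM⟩ := hbdd
    obtain ⟨F, hF⟩ := (isCompact_Icc (a := -M) (b := M)).exists_bound_of_continuousOn
      hf.continuous.continuousOn
    exact hweak.exists_gradient_bound hJ hk hc.le hu hM (hf.continuous.comp hu.continuous)
      fun x => hF (u x) (abs_le.1 (hM x))
  have hK₀0 : 0 ≤ K₀ := (integral_nonneg fun x => by positivity).trans (hK₀ 0)
  -- localisation around `x₀` and `y₀`
  set m₀ := fderiv ℝ u x₀ e / 2 with hm₀
  have hm₀0 : 0 < m₀ := by positivity
  have hx₀' : ∀ᶠ x in 𝓝 x₀, m₀ < fderiv ℝ u x e :=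
    hcont.continuousAt.eventually (lt_mem_nhds (by linarith))
  obtain ⟨ρ₁, hρ₁, hb₁⟩ := Metric.eventually_nhds_iff_ball.1 hx₀'
  obtain ⟨ρ₂, hρ₂, hb₂⟩ := Metric.eventually_nhds_iff_ball.1 hy₀
  -- Half of the radius is kept in reserve for the shift by `h e`, so that the difference quotient
  -- inherits the sign of the derivative on the balls of radius `ρ`.
  set ρ := min ρ₁ ρ₂ / 2 with hρ
  have hρ0 : 0 < ρ := by positivity
  have hρ1 : ρ + ρ ≤ ρ₁ := by rw [hρ]; linarith [min_le_left ρ₁ ρ₂]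
  have hρ2 : ρ + ρ ≤ ρ₂ := by rw [hρ]; linarith [min_le_right ρ₁ ρ₂]
  let bχ : ContDiffBump x₀ := ⟨ρ / 2, ρ, by positivity, by linarith⟩
  let bψ : ContDiffBump y₀ := ⟨ρ / 2, ρ, by positivity, by linarith⟩
  let χ : Euc 2 → ℝ := bχ
  let ψ : Euc 2 → ℝ := bψ
  have hχ : IsTest χ := ⟨bχ.contDiff, bχ.hasCompactSupport⟩
  have hψ : IsTest ψ := ⟨bψ.contDiff, bψ.hasCompactSupport⟩
  have hχ0 : ∀ x, 0 ≤ χ x := fun x => bχ.nonneg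
  have hψ0 : ∀ x, 0 ≤ ψ x := fun x => bψ.nonneg
  have hχs : ∀ x, x ∉ Metric.ball x₀ ρ → χ x = 0 := fun x hx =>
    bχ.zero_of_le_dist (not_lt.1 hx)
  have hψs : ∀ x, x ∉ Metric.ball y₀ ρ → ψ x = 0 := fun x hx =>
    bψ.zero_of_le_dist (not_lt.1 hx)
  have hχψ : ∀ x, χ x * ψ x = 0 := by
    intro x
    by_cases h1 : x ∈ Metric.ball x₀ ρ
    · by_cases h2 : x ∈ Metric.ball y₀ ρ
      · have h3 := hb₁ x (Metric.ball_subset_ball (by linarith) h1)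
        have h4 := hb₂ x (Metric.ball_subset_ball (by linarith) h2)
        linarith
      · rw [hψs x h2, mul_zero]
    · rw [hχs x h1, zero_mul]
  have hχψE : energy J χ ψ < 0 := by
    refine energy_neg_of_mul_eq_zero hJ hk hpos hχ hψ hχ0 hψ0 hχψ (x₀ := x₀) (y₀ := y₀) ?_ ?_ hxy
    · exact bχ.pos_of_mem_ball (Metric.mem_ball_self hρ0)
    · exact bψ.pos_of_mem_ball (Metric.mem_ball_self hρ0)
  -- A lower bound for the interaction that does not depend on `h`, `η` or `r`, so it can be fixed
  -- before they are chosen.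
  set m := m₀ * -energy J χ ψ with hm
  have hm0 : 0 < m := mul_pos hm₀0 (neg_pos.2 hχψE)
  set Q := (∫ x, ‖∇ ψ x‖ ^ 2) + c / 2 * energy J ψ ψ - ∫ x, deriv f (u x) * ψ x ^ 2 with hQ
  -- choice of the parameters
  set t := c * m / (4 * (|Q| + 1)) with ht
  have ht0 : 0 < t := by positivity
  set T := c * t * m with hT
  have hT0 : 0 < T := by positivity
  have htQ : t ^ 2 * Q ≤ T / 4 := by
    have h1 : t * (4 * (|Q| + 1)) = c * m := by rw [ht]; field_simp
    have h2 : t * Q ≤ c * m / 4 := by nlinarith [le_abs_self Q]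
    calc t ^ 2 * Q = t * (t * Q) := by ring
      _ ≤ t * (c * m / 4) := by gcongr
      _ = T / 4 := by rw [hT]; ring
  -- The order of choice is essential: `t` and the gain `T`, then `η`, then the step `h` (the
  -- linearization error must be small on the support of `η`), and finally `κ` and `r`, since `E₁`
  -- and `E₂` depend on `h` and `η`.
  obtain ⟨η, hη, hη01, hη1, hηw⟩ := exists_cutoff hJ hk hk' (K := ‖e‖ ^ 2 * K₀) (by positivity)
    (‖x₀‖ + ρ) (s := T / (8 * (2 + c))) (by positivity)
  obtain ⟨R, -, hR⟩ := hη.exists_support_subset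
  set I := ∫ x, η x ^ 2 with hI
  have hI0 : 0 ≤ I := integral_nonneg fun x => sq_nonneg _
  obtain ⟨h₀, hh₀, herr⟩ := exists_diffQuot_error_le hf hu hbdd e R
    (s := T / (8 * (I + 1))) (by positivity)
  set h := min h₀ (ρ / (‖e‖ + 1)) with hh
  have hhpos : 0 < h := by positivity
  have hhe : h * ‖e‖ ≤ ρ := by
    have : h * (‖e‖ + 1) ≤ ρ := (le_div_iff₀ (by positivity)).1 (min_le_right _ _)
    nlinarith
  set w := diffQuot u e h with hw
  set g : Euc 2 → ℝ := fun x => h⁻¹ * (f (u (x + h • e)) - f (u x)) with hg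
  have hwC : ContDiff ℝ 1 w := contDiff_diffQuot hu e h
  have hwM := exists_diffQuot_bound hbdd e h
  have hgc : Continuous g := by
    have := hf.continuous
    have := hu.continuous
    fun_prop
  have hww : IsWeakSolution J c w g := by
    have hub : ∃ M, ∀ x, |u (x + h • e)| ≤ M := hbdd.imp fun M hM x => hM _
    exact (hweak.comp_add (h • e)).smul_sub hJ hk hweak
      (hu.comp (contDiff_id.add contDiff_const)) hu hub hbdd
      (hf.continuous.comp (hu.continuous.comp (continuous_id.add continuous_const)))
      (hf.continuous.comp hu.continuous) h⁻¹
  have hseg : ∀ (a x : Euc 2), x ∈ Metric.ball a ρ → ∀ τ ∈ Set.Icc (0 : ℝ) h,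
      x + τ • e ∈ Metric.ball a (ρ + ρ) := by
    intro a x hx τ hτ
    rw [Metric.mem_ball, dist_eq_norm] at hx ⊢
    have h1 : ‖τ • e‖ ≤ ρ := by
      rw [norm_smul, Real.norm_of_nonneg hτ.1]
      exact (mul_le_mul_of_nonneg_right hτ.2 (norm_nonneg _)).trans hhe
    calc ‖x + τ • e - a‖ = ‖(x - a) + τ • e‖ := by congr 1; abel
      _ ≤ ‖x - a‖ + ‖τ • e‖ := norm_add_le _ _
      _ < ρ + ρ := by linarith
  have hwx : ∀ x ∈ Metric.ball x₀ ρ, m₀ ≤ w x := by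
    intro x hx
    obtain ⟨τ, hτ, he⟩ := exists_diffQuot_eq hd e hhpos x
    rw [hw, he]
    exact (hb₁ _ (Metric.ball_subset_ball hρ1 (hseg x₀ x hx τ hτ))).le
  have hwy : ∀ x ∈ Metric.ball y₀ ρ, w x ≤ 0 := by
    intro x hx
    obtain ⟨τ, hτ, he⟩ := exists_diffQuot_eq hd e hhpos x
    rw [hw, he]
    exact hb₂ _ (Metric.ball_subset_ball hρ2 (hseg y₀ x hx τ hτ))
  set E₁ := ∫ x, ‖∇ w x‖ ^ 2 * η x ^ 2 with hE₁
  set E₂ := ∫ p : Euc 2 × Euc 2, (w p.1 - w p.2) ^ 2 * η p.2 ^ 2 * J (p.1 - p.2) with hE₂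
  have hE₁0 : 0 ≤ E₁ := integral_nonneg fun x => by positivity
  have hE₂0 : 0 ≤ E₂ := integral_nonneg fun p => mul_nonneg (by positivity) (hJ.nonneg _)
  set κ := T / (8 * (2 * E₁ + c * E₂ + 1)) with hκ
  have hκ0 : 0 < κ := by positivity
  have hκE : κ * (2 * E₁ + c * E₂) ≤ T / 8 := by
    have : κ * (8 * (2 * E₁ + c * E₂ + 1)) = T := by rw [hκ]; field_simp
    nlinarith
  obtain ⟨r, hr, hr01, hr0, hr1, hrd, hrl⟩ := exists_value_cutoff hκ0 hm₀0
  -- the test function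
  set σ : Euc 2 → ℝ := fun x => r (w x) * η x with hσ
  have hσt : IsTest σ := isTest_valueCutoff hwC hη hr
  have hσ0 : ∀ x, 0 ≤ w x * σ x := by
    intro x
    rcases le_or_gt (w x) 0 with h1 | h1
    · simp [hσ, hr0 _ h1]
    · exact mul_nonneg h1.le (mul_nonneg (hr01 _).1 (hη01 x).1)
  have hdis : ∀ x, w x * σ x * ψ x = 0 := by
    intro x
    by_cases h1 : x ∈ Metric.ball y₀ ρ
    · simp [hσ, hr0 _ (hwy x h1)]
    · rw [hψs x h1, mul_zero]
  have hlow : ∀ x, m₀ * χ x ≤ w x * σ x := by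
    intro x
    by_cases h1 : x ∈ Metric.ball x₀ ρ
    · have h2 : ‖x‖ ≤ ‖x₀‖ + ρ := by
        rw [Metric.mem_ball, dist_eq_norm] at h1
        have := norm_le_norm_add_norm_sub x₀ x
        rw [norm_sub_rev] at this
        linarith
      have h3 := hwx x h1
      have h4 : χ x ≤ 1 := bχ.le_one
      simp only [hσ]
      rw [hη1 x h2, hr1 _ h3, mul_one, mul_one]
      exact (mul_le_of_le_one_right hm₀0.le h4).trans h3
    · rw [hχs x h1, mul_zero]
      exact hσ0 x
  -- The remainder `w σ - m₀ χ` is nonnegative and vanishes where `ψ` does not, so its interaction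
  -- with `ψ` only helps.
  have hlowE : energy J (fun x => w x * σ x) ψ ≤ -m := by
    have hWt : IsTest fun x => w x * σ x := IsTest.mul_left hwC hσt
    have h1 : energy J (fun x => w x * σ x + -m₀ * χ x) ψ ≤ 0 := by
      refine energy_nonpos_of_mul_eq_zero hJ (fun x => by linarith [hlow x]) hψ0 fun x => ?_
      linear_combination hdis x - m₀ * hχψ x
    have h2 : energy J (fun x => w x * σ x + -m₀ * χ x) ψ =
        energy J (fun x => w x * σ x) ψ + -m₀ * energy J χ ψ := by
      unfold energy
      rw [← integral_const_mul, ← integral_add (hWt.integrable_energy hJ hk hψ)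
        ((hχ.integrable_energy hJ hk hψ).const_mul _)]
      refine integral_congr_ae (Eventually.of_forall fun p => ?_)
      simp only
      ring
    rw [h2] at h1
    rw [hm]
    linarith
  have hmain := hstab.le_of_disjoint hJ hk hfu hww hwC hwM hgc hσt hψ hσ0 hψ0 hdis t
  -- estimates of the four terms
  obtain ⟨hw1, hwi, hw2⟩ := hηw w hwC.continuous
    (setIntegral_diffQuot_sq_le hu hK₀ e hhpos)
  have b1 := integral_gradient_valueCutoff_le hwC hη hr hr01 hrd
  have b2 := integral_energy_valueCutoff_le hJ hk hwC hwM hη hr hr01 hr0 hκ0.le hrl hwi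
  have b3 : ∫ x, (g x * w x - deriv f (u x) * w x ^ 2) * σ x ^ 2 ≤ T / 8 := by
    have hcw := hwC.continuous
    calc ∫ x, (g x * w x - deriv f (u x) * w x ^ 2) * σ x ^ 2
        ≤ ∫ x, T / (8 * (I + 1)) * η x ^ 2 := by
          refine integral_mono (hσt.sq.integrable_mul (by fun_prop))
            (hη.sq.integrable_mul continuous_const) fun x => ?_
          by_cases hx : η x = 0
          · simp [hσ, hx]
          · have h1 := herr h hhpos (min_le_left _ _) x (mem_closedBall_zero_iff.1 (hR x hx))
            have h2 : σ x ^ 2 ≤ η x ^ 2 := by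
              simp only [hσ, mul_pow]
              exact mul_le_of_le_one_left (sq_nonneg _) (pow_le_one₀ (hr01 _).1 (hr01 _).2)
            exact mul_le_mul ((le_abs_self _).trans h1) h2 (sq_nonneg _) (by positivity)
      _ = T / (8 * (I + 1)) * I := by rw [integral_const_mul]
      _ ≤ T / 8 := by
          rw [div_mul_eq_mul_div, div_le_div_iff₀ (by positivity) (by norm_num)]
          nlinarith
  have hs : (2 + c) * (T / (8 * (2 + c))) = T / 8 := by field_simp
  have b4 : T ≤ -(c * t * energy J (fun x => w x * σ x) ψ) := by
    have := mul_le_mul_of_nonneg_left hlowE (by positivity : 0 ≤ c * t)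
    rw [hT]
    linarith
  have b5 : c / 2 * (∫ p : Euc 2 × Euc 2, w p.1 * w p.2 * (σ p.1 - σ p.2) ^ 2 * J (p.1 - p.2)) ≤
      c * (T / (8 * (2 + c))) + κ * (c * E₂) := by
    have h1 := mul_le_mul_of_nonneg_left b2 (by positivity : 0 ≤ c / 2)
    have h2 := mul_le_mul_of_nonneg_left hw2 hc.le
    linarith
  rw [← hσ, ← hE₁] at b1
  rw [← hQ] at hmain
  -- The gain `T` is bounded by `T/8` each for the spatial cutoff, the value cutoff and the
  -- linearization error, plus `T/4` for the `t²` term: `5T/8 < T`.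
  linarith

end JumpDiffusion

/-! ### From constant signs to one-dimensional symmetry. -/

namespace JumpDiffusion

/-- If nonpositivity on a neighbourhood of a point extends to the ball of radius `δ` around it,
a continuous function that is negative somewhere is nonpositive everywhere. -/
theorem nonpos_of_propagates {n : ℕ} {v : Euc n → ℝ} (hv : Continuous v) {δ : ℝ} (hδ : 0 < δ)
    (h : ∀ y, (∀ᶠ x in 𝓝 y, v x ≤ 0) → ∀ x, ‖x - y‖ < δ → v x ≤ 0) {y₀ : Euc n}
    (hy₀ : v y₀ < 0) (x : Euc n) : v x ≤ 0 := by
  set U : Set (Euc n) := interior {x | v x ≤ 0} with hU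
  have hball : ∀ y ∈ U, Metric.ball y δ ⊆ U := by
    intro y hy
    refine interior_maximal (fun x hx => ?_) Metric.isOpen_ball
    refine h y (mem_interior_iff_mem_nhds.1 hy) x ?_
    rwa [← dist_eq_norm]
  -- The propagation radius is uniform, so a limit point of `U` lies in the `δ`-ball around some
  -- point of `U`.
  have hclosed : IsClosed U := by
    refine isClosed_of_closure_subset fun x hx => ?_
    obtain ⟨y, hy, hxy⟩ := Metric.mem_closure_iff.1 hx δ hδ
    exact hball y hy hxy
  have hne : U.Nonempty := by
    refine ⟨y₀, mem_interior_iff_mem_nhds.2 ?_⟩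
    filter_upwards [hv.continuousAt.eventually (gt_mem_nhds hy₀)] with x hx using hx.le
  have huniv : U = Set.univ := IsClopen.eq_univ ⟨hclosed, isOpen_interior⟩ hne
  have hx : x ∈ U := huniv ▸ Set.mem_univ x
  have hx' : x ∈ {x | v x ≤ 0} := interior_subset hx
  exact hx'

/-- A function all of whose directional derivatives have a sign is one-dimensional. -/
theorem isOneDimensional_of_fderiv_sign {n : ℕ} {τ₀ : Euc n} (hτ₀ : ‖τ₀‖ = 1) {u : Euc n → ℝ}
    (hu : Differentiable ℝ u)
    (hsign : ∀ e : Euc n, (∃ y, fderiv ℝ u y e < 0) → ∀ x, fderiv ℝ u x e ≤ 0) :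
    IsOneDimensional u := by
  have along : ∀ x v : Euc n, (∀ y, fderiv ℝ u y v = 0) → u (x + v) = u x := by
    intro x v hv
    have hφ : ∀ t, HasDerivAt (fun t : ℝ => u (x + t • v)) 0 t := by
      intro t
      have h1 : HasDerivAt (fun t : ℝ => x + t • v) v t := by
        simpa using ((hasDerivAt_id t).smul_const v).const_add x
      exact ((hu (x + t • v)).hasFDerivAt.comp_hasDerivAt t h1).congr_deriv (hv _)
    have := is_const_of_deriv_eq_zero (fun t => (hφ t).differentiableAt) (fun t => (hφ t).deriv) 1 0
    simpa using this
  by_cases hall : ∀ x, ∇ u x = 0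
  · refine ⟨τ₀, fun _ => u 0, hτ₀, fun x => ?_⟩
    have := along 0 x fun y => by rw [← inner_gradient_left, hall y, inner_zero_left]
    simpa using this
  · push Not at hall
    obtain ⟨x₀, hx₀⟩ := hall
    set ν := ∇ u x₀ with hν
    have hν0 : 0 < ‖ν‖ := norm_pos_iff.2 hx₀
    -- Tilting `e` to `e - s ν` makes the derivative at `x₀` strictly negative, which triggers the
    -- sign hypothesis; then `s → 0`. Using `-e` as well gives equality.
    have half : ∀ e : Euc n, inner ℝ ν e = 0 → ∀ x, fderiv ℝ u x e ≤ 0 := by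
      intro e he x
      have hs : ∀ s : ℝ, 0 < s → fderiv ℝ u x e - s * fderiv ℝ u x ν ≤ 0 := by
        intro s hs
        have h1 : fderiv ℝ u x₀ (e - s • ν) < 0 := by
          rw [← inner_gradient_left, ← hν, inner_sub_right, he, real_inner_smul_right,
            real_inner_self_eq_norm_sq]
          have : 0 < s * ‖ν‖ ^ 2 := by positivity
          linarith
        have h2 := hsign _ ⟨x₀, h1⟩ x
        rwa [map_sub, map_smul, smul_eq_mul] at h2
      have hlim : Tendsto (fun s : ℝ => fderiv ℝ u x e - s * fderiv ℝ u x ν) (𝓝[>] 0)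
          (𝓝 (fderiv ℝ u x e)) := by
        have : ContinuousAt (fun s : ℝ => fderiv ℝ u x e - s * fderiv ℝ u x ν) 0 := by fun_prop
        have := this.tendsto
        simp only [zero_mul, sub_zero] at this
        exact this.mono_left nhdsWithin_le_nhds
      exact le_of_tendsto hlim (eventually_mem_nhdsWithin.mono hs)
    have hzero : ∀ e : Euc n, inner ℝ ν e = 0 → ∀ x, fderiv ℝ u x e = 0 := by
      intro e he x
      refine le_antisymm (half e he x) ?_
      have := half (-e) (by rw [inner_neg_right, he, neg_zero]) x
      rw [map_neg] at this
      linarith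
    refine ⟨‖ν‖⁻¹ • ν, fun s => u (s • ‖ν‖⁻¹ • ν), ?_, fun x => ?_⟩
    · rw [norm_smul, norm_inv, norm_norm, inv_mul_cancel₀ hν0.ne']
    · have := along ((inner ℝ (‖ν‖⁻¹ • ν) x : ℝ) • ‖ν‖⁻¹ • ν)
        (x - (inner ℝ (‖ν‖⁻¹ • ν) x : ℝ) • ‖ν‖⁻¹ • ν) (hzero _ ?_)
      · rw [add_sub_cancel] at this
        exact this
      · simp only [inner_sub_right, real_inner_smul_left, real_inner_smul_right,
          real_inner_self_eq_norm_sq]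
        field_simp
        ring

end JumpDiffusion

theorem theorem2p4
    (J : EuclideanSpace ℝ (Fin 2) → ℝ) (hJ : JumpDiffusion.IsJumpKernel J)
    (lam Lam α β δ₀ : ℝ) (hlam : 0 < lam) (hLam : 0 < Lam)
    (hα : 0 < α) (hα2 : α < 2) (hβ : 0 < β) (hβ2 : β < 2) (hδ₀ : 0 < δ₀)
    (hJnear : JumpDiffusion.ComparableNearOrigin J lam Lam α β δ₀)
    (D : ℝ → ℝ) (hDcont : ContinuousOn D (Set.Ioi 0)) (hDnonneg : ∀ r : ℝ, 0 < r → 0 ≤ D r)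
    (hDlim : Filter.Tendsto D Filter.atTop (nhds 0))
    (C₁ C₂ θ : ℝ) (hθ : 3 < θ)
    (hJdecay : JumpDiffusion.AnnulusDecay J C₁ D δ₀)
    (hD : ∀ r : ℝ, δ₀ < r → D r < C₂ * r ^ (-θ))
    (c : ℝ) (hc : 0 < c)
    (f : ℝ → ℝ) (hf : ContDiff ℝ 1 f)
    (u : EuclideanSpace ℝ (Fin 2) → ℝ)
    (hbdd : ∃ M : ℝ, ∀ x, |u x| ≤ M)
    (hsol : JumpDiffusion.IsSolution J c f u)
    (hstab : JumpDiffusion.IsStable J c f u) :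
    JumpDiffusion.IsOneDimensional u := by
  obtain ⟨hk, hk'⟩ := JumpDiffusion.integrable_moments hJ hα2 hδ₀ hJnear hDnonneg hθ hJdecay hD
  have hu : ContDiff ℝ 1 u := hsol.1.of_le (by norm_num)
  -- The lower bound on `J` near the origin enters only as strict positivity, and `δ₀` becomes the
  -- propagation distance.
  have hpos : ∀ z : EuclideanSpace ℝ (Fin 2), 0 < ‖z‖ → ‖z‖ ≤ δ₀ → 0 < J z := fun z h0 hz =>
    (div_pos hlam (Real.rpow_pos_of_pos h0 _)).trans_le (hJnear z h0 hz).1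
  refine JumpDiffusion.isOneDimensional_of_fderiv_sign (τ₀ := EuclideanSpace.single 0 1) (by simp)
    (hu.differentiable one_ne_zero) ?_
  rintro e ⟨y, hy⟩ x
  refine JumpDiffusion.nonpos_of_propagates (v := fun y => fderiv ℝ u y e)
    ((hu.continuous_fderiv one_ne_zero).clm_apply continuous_const) hδ₀ ?_ hy x
  exact fun y hy x hxy => JumpDiffusion.fderiv_nonpos_propagates hJ hk hk' hpos hc hf hbdd hsol
    hstab e y hy x hxy
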